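/- Let $\Gamma\rightrightarrows\Gamma_0$ be a Lie groupoid (finite-dimensional, smooth, without boundary; $\Gamma$ is possibly non-Hausdorff, and $\Gamma_0$ is Hausdorff and embedded in $\Gamma$ through the unit section) with target map $\alpha$, source map $\beta$ (both submersions $\Gamma\to\Gamma_0$), product $m(x,y)$ defined and smooth for $\beta(x)=\alpha(y)$, and inverse map $\iota$, a diffeomorphism of $\Gamma$. Call it, with a symplectic form $\omega$ on $\Gamma$, a symplectic groupoid if the graph $\{(x,y,m(x,y)) : \beta(x)=\alpha(y)\}$ is a Lagrangian submanifold of $\Gamma\times\Gamma\times\Gamma$ with the symplectic form $\mathrm{pr}_1^*\omega+\mathrm{pr}_2^*\omega-\mathrm{pr}_3^*\omega$. Call it, with a Poisson bivector field $\Pi$ on $\Gamma$, a Poisson groupoid if this graph is a coisotropic submanifold of $\Gamma\times\Gamma\times\Gamma$ with the product of the Poisson structures $\Pi$, $\Pi$ and $-\Pi$. Here a submanifold $N$ of a symplectic manifold is Lagrangian if each $T_xN$ is equal to its symplectic orthogonal, and a submanifold $N$ of a Poisson manifold is coisotropic if the bracket of any two smooth functions which are defined on an open subset and vanish on $N$ vanishes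 on $N$ too. The Poisson bracket is $\{f,g\}=\Pi(df,dg)$; a symplectic manifold carries the Poisson structure for which $\Pi^\sharp$, defined by $\langle\eta,\Pi^\sharp(\zeta)\rangle=\Pi(\zeta,\eta)$, is the inverse of $v\mapsto -i(v)\omega$. **Theorem.** Let $\Gamma\rightrightarrows\Gamma_0$ be a symplectic groupoid with symplectic form $\omega$ (resp. a Poisson groupoid with Poisson structure $\Pi$). 1. For a symplectic groupoid and any point $c\in\Gamma$, each of the two subspaces $T_c\bigl(\beta^{-1}(\beta(c))\bigr)$ and $T_c\bigl(\alpha^{-1}(\alpha(c))\bigr)$ of $\bigl(T_c\Gamma,\omega(c)\bigr)$ is the symplectic orthogonal of the other. For a symplectic or Poisson groupoid, if $f$ and $g$ are smooth functions on $\Gamma$ such that $f$ is constant on each $\alpha$-fiber and $g$ is constant on each $\beta$-fiber, then $\{f,g\}$ vanishes identically. 2. The set of units $\Gamma_0$ is a Lagrangian submanifold of $(\Gamma,\omega)$ (resp. a coisotropic submanifold of $(\Gamma,\Pi)$). 3. The inverse map satisfies $\iota^*\omega=-\omega$ (resp. $\iota_*\Pi=-\Pi$). -/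

import Mathlib

open scoped Manifold ContDiff Topology
open Set Filter

noncomputable section

section Tensors

variable {E : Type*} [NormedAddCommGroup E] [NormedSpace ℝ E]
  {H : Type*} [TopologicalSpace H] (I : ModelWithCorners ℝ E H)
  {E' : Type*} [NormedAddCommGroup E'] [NormedSpace ℝ E']
  {H' : Type*} [TopologicalSpace H'] (I' : ModelWithCorners ℝ E' H')
  {M : Type*} [TopologicalSpace M] [ChartedSpace H M]
  {M' : Type*} [TopologicalSpace M'] [ChartedSpace H' M']

/-! ### Differential 2-forms and symplectic forms -/

variable (M) in
/-- A (not necessarily smooth) differential `2`-form on the manifold `M`. -/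
abbrev TwoForm : Type _ := ∀ x : M, TangentSpace I x [⋀^Fin 2]→L[ℝ] ℝ

/-- The pullback `f^* Ω` of a `2`-form. -/
def pullbackForm (f : M → M') (Ω : TwoForm I' M') : TwoForm I M := fun x =>
  (Ω (f x)).compContinuousLinearMap (mfderiv I I' f x)

/-- The expression of a `2`-form in the preferred chart around `x₀`: its pullback under the
inverse of the chart. It is meaningful on the target of the chart, which is an open subset of
the model space `E` when `I` has no boundary. -/
def TwoForm.inChart (Ω : TwoForm I M) (x₀ : M) : E → E [⋀^Fin 2]→L[ℝ] ℝ :=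
  pullbackForm 𝓘(ℝ, E) I (extChartAt I x₀).symm Ω

/-- A symplectic form on a manifold without boundary: a smooth, closed and
nondegenerate `2`-form. -/
structure IsSymplectic (Ω : TwoForm I M) : Prop where
  smooth : ∀ x₀ : M, ContDiffOn ℝ ∞ (TwoForm.inChart I Ω x₀) (extChartAt I x₀).target
  closed : ∀ x₀ : M, ∀ u ∈ (extChartAt I x₀).target, extDeriv (TwoForm.inChart I Ω x₀) u = 0
  nondegenerate : ∀ (x : M) (v : TangentSpace I x), v ≠ 0 →
    ∃ w : TangentSpace I x, Ω x ![v, w] ≠ 0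

/-! ### Bivector fields and Poisson structures -/

variable (M) in
/-- A (not necessarily smooth) bivector field on the finite-dimensional manifold `M`:
an element of `⋀² T_x M` is an alternating bilinear form on the cotangent space at `x`. -/
abbrev BivectorField : Type _ :=
  ∀ x : M, (TangentSpace I x →L[ℝ] ℝ) [⋀^Fin 2]→L[ℝ] ℝ

/-- The image of the bivector `P x` under the tangent map of `f` at `x`:
it sends covectors `ζ`, `η` at `f x` to `P x (ζ ∘ T_x f, η ∘ T_x f)`. -/
def pushBivector (f : M → M') (P : BivectorField I M) (x : M) :
    (TangentSpace I' (f x) →L[ℝ] ℝ) [⋀^Fin 2]→L[ℝ] ℝ :=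
  (P x).compContinuousLinearMap (ContinuousLinearMap.precomp ℝ (mfderiv I I' f x))

/-- The expression of a bivector field in the preferred chart around `x₀`: its image under
the chart. -/
def BivectorField.inChart (P : BivectorField I M) (x₀ : M) :
    E → (E →L[ℝ] ℝ) [⋀^Fin 2]→L[ℝ] ℝ := fun u =>
  pushBivector I 𝓘(ℝ, E) (extChartAt I x₀) P ((extChartAt I x₀).symm u)

/-- The Schouten bracket of two bivector fields `P`, `Q` on a vector space, evaluated at the
point `u` on three constant covectors; in linear coordinates this is the formula
`[P, Q]^{ijk} = ∑_l (P^{il} ∂_l Q^{jk} + Q^{il} ∂_l P^{jk}) + cyclic permutations of i, j, k`. -/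
def schoutenBracket (P Q : E → (E →L[ℝ] ℝ) [⋀^Fin 2]→L[ℝ] ℝ) (u : E) (a b c : E →L[ℝ] ℝ) : ℝ :=
  let t : (E →L[ℝ] ℝ) → (E →L[ℝ] ℝ) → (E →L[ℝ] ℝ) → ℝ := fun a b c =>
    P u ![a, fderiv ℝ (fun v => Q v ![b, c]) u] + Q u ![a, fderiv ℝ (fun v => P v ![b, c]) u]
  t a b c + t b c a + t c a b

/-- A Poisson structure on a finite-dimensional manifold without boundary: a smooth bivector
field `P` with `[P, P] = 0`. -/
structure IsPoisson (P : BivectorField I M) : Prop where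
  smooth : ∀ x₀ : M, ContDiffOn ℝ ∞ (BivectorField.inChart I P x₀) (extChartAt I x₀).target
  schouten : ∀ x₀ : M, ∀ u ∈ (extChartAt I x₀).target, ∀ a b c : E →L[ℝ] ℝ,
    schoutenBracket (BivectorField.inChart I P x₀) (BivectorField.inChart I P x₀) u a b c = 0

/-- The differential of a real function at a point, as a covector. -/
def differentialAt (f : M → ℝ) (x : M) : TangentSpace I x →L[ℝ] ℝ :=
  mfderiv I 𝓘(ℝ, ℝ) f x

/-- The Poisson bracket `{f, g}(x) = P(df(x), dg(x))`. -/
def poissonBracket (P : BivectorField I M) (f g : M → ℝ) (x : M) : ℝ :=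
  P x ![differentialAt I f x, differentialAt I g x]

/-! ### The Poisson structure of a symplectic manifold -/

/-- The linear map `v ↦ -i(v)σ` attached to an alternating bilinear form `σ`. -/
def negInterior (σ : E [⋀^Fin 2]→L[ℝ] ℝ) : E →L[ℝ] (E →L[ℝ] ℝ) :=
  -((ContinuousAlternatingMap.ofSubsingletonLIE (𝕜 := ℝ) (E := E) (F := ℝ)
    (0 : Fin 1)).symm.toContinuousLinearEquiv.toContinuousLinearMap ∘L σ.curryLeft)

theorem negInterior_apply (σ : E [⋀^Fin 2]→L[ℝ] ℝ) (v w : E) :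
    negInterior σ v w = -σ ![v, w] := by
  have h : (fun _ : Fin 1 => w) = ![w] := by
    ext i; fin_cases i; rfl
  change -(σ.curryLeft v (fun _ : Fin 1 => w)) = _
  rw [h]; rfl

/-- The bivector of a nondegenerate alternating form `σ`: with `♯` the inverse of
`v ↦ -i(v)σ`, it is `(ζ, η) ↦ σ(♯ζ, ♯η)`, which is also `⟨η, ♯ζ⟩`
(see `dualBivector_apply`). -/
def dualBivector (σ : E [⋀^Fin 2]→L[ℝ] ℝ) : (E →L[ℝ] ℝ) [⋀^Fin 2]→L[ℝ] ℝ :=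
  σ.compContinuousLinearMap (negInterior σ).inverse

theorem dualBivector_apply [FiniteDimensional ℝ E] (σ : E [⋀^Fin 2]→L[ℝ] ℝ)
    (hσ : ∀ v : E, v ≠ 0 → ∃ w : E, σ ![v, w] ≠ 0) (v : E) (η : E →L[ℝ] ℝ) :
    dualBivector σ ![negInterior σ v, η] = η v := by
  have hinj : Function.Injective (negInterior σ) := by
    rw [injective_iff_map_eq_zero]
    intro v hv
    by_contra hne
    obtain ⟨w, hw⟩ := hσ v hne
    apply hw
    have := negInterior_apply σ v w
    rw [hv] at this
    simpa using this.symm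
  have hdim : Module.finrank ℝ E = Module.finrank ℝ (E →L[ℝ] ℝ) := by
    rw [← (LinearMap.toContinuousLinearMap (𝕜 := ℝ) (E := E) (F' := ℝ)).finrank_eq]
    exact (Subspace.dual_finrank_eq (K := ℝ) (V := E)).symm
  let e : E ≃L[ℝ] (E →L[ℝ] ℝ) :=
    (LinearEquiv.ofInjectiveOfFinrankEq (negInterior σ).toLinearMap hinj
      hdim).toContinuousLinearEquiv
  have he : (e : E →L[ℝ] (E →L[ℝ] ℝ)) = negInterior σ := by
    ext; rfl
  have key : ∀ u, (negInterior σ).inverse (negInterior σ u) = u := by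
    intro u
    rw [← he, ContinuousLinearMap.inverse_equiv]
    exact e.symm_apply_apply u
  obtain ⟨w, rfl⟩ : ∃ w, negInterior σ w = η := ⟨e.symm η, e.apply_symm_apply η⟩
  have h1 : dualBivector σ ![negInterior σ v, negInterior σ w] = σ ![v, w] := by
    change σ _ = _
    congr 1
    ext i
    fin_cases i
    · exact key v
    · exact key w
  have h2 : σ ![w, v] = -σ ![v, w] := by
    have := σ.toAlternatingMap.map_swap ![v, w] (i := 0) (j := 1) (by decide)
    rw [show (![v, w] ∘ Equiv.swap (0 : Fin 2) 1) = ![w, v] by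
      ext i; fin_cases i <;> rfl] at this
    exact this
  rw [h1, negInterior_apply, h2, neg_neg]

/-- The Poisson structure of a symplectic manifold `(M, Ω)`, for which `P^♯ : T^*M → TM`,
`⟨η, P^♯ ζ⟩ = P(ζ, η)`, is the inverse of `v ↦ -i(v)Ω`. -/
def symplecticPoisson (Ω : TwoForm I M) : BivectorField I M := fun x =>
  dualBivector (E := E) (Ω x)

/-! ### Submanifolds -/

/-- `N` is an (embedded, smooth) submanifold of `M`: around each point of `N` there is a smooth
chart of `M` in which `N` is a linear slice. -/
def IsSubmanifold (N : Set M) : Prop :=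
  ∀ x ∈ N, ∃ φ ∈ IsManifold.maximalAtlas I ∞ M, x ∈ φ.source ∧
    ∃ W : Submodule ℝ E, ∀ y ∈ φ.source, y ∈ N ↔ φ.extend I y - φ.extend I x ∈ W

/-- The tangent space `T_x N` of a submanifold `N` of `M`, as a subset of `T_x M`: the
velocities at `x` of the smooth curves through `x` that lie in `N`. -/
def tangentSet (N : Set M) (x : M) : Set (TangentSpace I x) :=
  {v | ∃ γ : ℝ → M, γ 0 = x ∧ (∀ᶠ t in 𝓝 (0 : ℝ), γ t ∈ N) ∧
    ContMDiffAt 𝓘(ℝ, ℝ) I ∞ γ 0 ∧ mfderiv 𝓘(ℝ, ℝ) I γ 0 (1 : ℝ) = v}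

variable {I} in
/-- The symplectic orthogonal, in the tangent space at `x`, of a set of tangent vectors. -/
def symplecticOrthogonal (Ω : TwoForm I M) (x : M) (W : Set (TangentSpace I x)) :
    Set (TangentSpace I x) :=
  {v | ∀ w ∈ W, Ω x ![v, w] = 0}

/-- `N` is a Lagrangian submanifold of the symplectic manifold `(M, Ω)`. -/
def IsLagrangianSubmanifold (Ω : TwoForm I M) (N : Set M) : Prop :=
  IsSubmanifold I N ∧ ∀ x ∈ N, tangentSet I N x = symplecticOrthogonal Ω x (tangentSet I N x)

/-- `N` is a coisotropic submanifold of the Poisson manifold `(M, P)`: the bracket of two smooth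
functions, defined on an open subset of `M` and which vanish on `N`, vanishes on `N` too. -/
def IsCoisotropicSubmanifold (P : BivectorField I M) (N : Set M) : Prop :=
  IsSubmanifold I N ∧ ∀ (U : Set M) (f g : M → ℝ), IsOpen U →
    ContMDiffOn I 𝓘(ℝ, ℝ) ∞ f U → ContMDiffOn I 𝓘(ℝ, ℝ) ∞ g U →
    (∀ x ∈ N ∩ U, f x = 0) → (∀ x ∈ N ∩ U, g x = 0) →
    ∀ x ∈ N ∩ U, poissonBracket I P f g x = 0

/-! ### Product structures on `M × M × M̄` -/

/-- The `2`-form `pr₁^* Ω + pr₂^* Ω - pr₃^* Ω` on `M × M × M`. -/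
def tripleForm (Ω : TwoForm I M) : TwoForm (I.prod (I.prod I)) (M × M × M) :=
  pullbackForm (I.prod (I.prod I)) I (fun p => p.1) Ω
    + pullbackForm (I.prod (I.prod I)) I (fun p => p.2.1) Ω
    - pullbackForm (I.prod (I.prod I)) I (fun p => p.2.2) Ω

/-- The product bivector field on `M × M × M` of `P`, `P` and `-P` on the three factors:
at a point it is the sum of the images of these bivectors under the inclusions of the factors
through that point. -/
def tripleBivector (P : BivectorField I M) :
    BivectorField (I.prod (I.prod I)) (M × M × M) := fun p =>
  pushBivector I (I.prod (I.prod I)) (fun x => (x, p.2.1, p.2.2)) P p.1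
    + pushBivector I (I.prod (I.prod I)) (fun y => (p.1, y, p.2.2)) P p.2.1
    - pushBivector I (I.prod (I.prod I)) (fun z => (p.1, p.2.1, z)) P p.2.2

end Tensors

/-! ### Lie groupoids -/

section Groupoids

variable {E : Type*} [NormedAddCommGroup E] [NormedSpace ℝ E]
  {H : Type*} [TopologicalSpace H] (I : ModelWithCorners ℝ E H)
  {E₀ : Type*} [NormedAddCommGroup E₀] [NormedSpace ℝ E₀]
  {H₀ : Type*} [TopologicalSpace H₀] (I₀ : ModelWithCorners ℝ E₀ H₀)
  (Γ : Type*) [TopologicalSpace Γ] [ChartedSpace H Γ]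
  (Γ₀ : Type*) [TopologicalSpace Γ₀] [ChartedSpace H₀ Γ₀]

/-- A Lie groupoid with total space `Γ` (possibly non-Hausdorff) and manifold of units `Γ₀`,
which is a Hausdorff submanifold of `Γ` through the embedding `unit`. The product `mul x y` is
meaningful only for composable pairs `(x, y)`, those with `source x = target y`; its values at
other pairs are irrelevant. -/
structure LieGroupoid where
  /-- the unit section `ε` -/
  unit : Γ₀ → Γ
  /-- the target map `α` -/
  target : Γ → Γ₀
  /-- the source map `β` -/
  source : Γ → Γ₀
  /-- the product `m` -/
  mul : Γ → Γ → Γ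
  /-- the inverse map `ι` -/
  inv : Γ ≃ₘ⟮I, I⟯ Γ
  target_unit : ∀ u, target (unit u) = u
  source_unit : ∀ u, source (unit u) = u
  /-- one side of the associativity equality is defined if and only if the other one is -/
  assoc_defined : ∀ x y z, (source y = target z ∧ source x = target (mul y z)) ↔
    (source x = target y ∧ source (mul x y) = target z)
  assoc : ∀ x y z, source y = target z → source x = target (mul y z) →
    mul x (mul y z) = mul (mul x y) z
  unit_mul : ∀ x, mul (unit (target x)) x = x
  mul_unit : ∀ x, mul x (unit (source x)) = x
  source_eq_target_inv : ∀ x, source x = target (inv x)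
  source_inv_eq_target : ∀ x, source (inv x) = target x
  mul_inv : ∀ x, mul x (inv x) = unit (target x)
  inv_mul : ∀ x, mul (inv x) x = unit (source x)
  t2_units : T2Space Γ₀
  embedding_unit : Manifold.IsSmoothEmbedding I₀ I ∞ unit
  /-- surjectivity of `target` and `source` follows from `target_unit` and `source_unit` -/
  submersion_target : Manifold.IsSubmersion I I₀ ∞ target
  submersion_source : Manifold.IsSubmersion I I₀ ∞ source
  /-- smoothness on the submanifold `Γ₂` of composable pairs -/
  contMDiffOn_mul : ContMDiffOn (I.prod I) I ∞ (fun p : Γ × Γ => mul p.1 p.2)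
    {p : Γ × Γ | source p.1 = target p.2}

variable {I I₀ Γ Γ₀}

namespace LieGroupoid

/-- The graph of the product. -/
def graph (G : LieGroupoid I I₀ Γ Γ₀) : Set (Γ × Γ × Γ) :=
  {p | G.source p.1 = G.target p.2.1 ∧ p.2.2 = G.mul p.1 p.2.1}

/-- `(G, Ω)` is a symplectic groupoid. -/
structure IsSymplecticGroupoid (G : LieGroupoid I I₀ Γ Γ₀) (Ω : TwoForm I Γ) : Prop where
  symplectic : IsSymplectic I Ω
  lagrangian_graph : IsLagrangianSubmanifold (I.prod (I.prod I)) (tripleForm I Ω) G.graph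

/-- `(G, P)` is a Poisson groupoid. -/
structure IsPoissonGroupoid (G : LieGroupoid I I₀ Γ Γ₀) (P : BivectorField I Γ) : Prop where
  poisson : IsPoisson I P
  coisotropic_graph : IsCoisotropicSubmanifold (I.prod (I.prod I)) (tripleBivector I P) G.graph

end LieGroupoid

end Groupoids

end

/-! The tangent space of the graph of the product at `(x, y, xy)` consists of the triples `(X, Y,
dMul x y (X, Y))` with `dSource x X = dTarget y Y` (`mem_tangentSet_graph`). The Lagrangian
condition thus becomes multiplicativity of the form (`isotropic`) together with maximality
(`mem_of_orthogonal`). The coisotropic condition becomes the vanishing of the triple bivector on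
pairs of conormal covectors (`conormal_eq_zero`). The theorem follows by testing these at
well-chosen points of the graph.

Part 1. At `(c, ε(β(c)), c)`, pair `(u, 0, u)`, `u` vertical for `β`, with `(0, v', v)`, `v`
vertical for `α`: this gives `ω(u, v) = 0`. Conversely, if `u` is orthogonal to the kernel of `dα`,
then `(u, 0, u)` is orthogonal to the graph, hence tangent to it, hence `dβ(u) = 0`; no dimension
count is needed. In the Poisson case the conormal covectors are the differentials of `f(x) - f(z)`
and `g(y) - g(z)`.

Part 2. At a unit the product is tangentially `X + Y` minus a vector tangent to the units
(`dMul_unit_unit`), so one tests vectors `(w, w, w)` and covectors `(ζ, ζ, -ζ)`.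

Part 3. At `(x, x⁻¹, ε(α(x)))`, a vector and its image under `dι` multiply to a vector tangent to
the units, and the contribution of the third factor vanishes by part 2. -/

noncomputable section

/-! ### Velocities of smooth curves. -/

section Velocity

variable {E : Type*} [NormedAddCommGroup E] [NormedSpace ℝ E]
  {H : Type*} [TopologicalSpace H] {I : ModelWithCorners ℝ E H}
  {E' : Type*} [NormedAddCommGroup E'] [NormedSpace ℝ E']
  {H' : Type*} [TopologicalSpace H'] {I' : ModelWithCorners ℝ E' H'}
  {M : Type*} [TopologicalSpace M] [ChartedSpace H M]
  {M' : Type*} [TopologicalSpace M'] [ChartedSpace H' M']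

variable (I) in
/-- The curve `γ` is smooth at `0`, where it passes through `x` with velocity `v`. -/
structure HasVelocity (γ : ℝ → M) (x : M) (v : E) : Prop where
  map_zero : γ 0 = x
  contMDiffAt : ContMDiffAt 𝓘(ℝ, ℝ) I ∞ γ 0
  velocity : (mfderiv 𝓘(ℝ, ℝ) I γ 0 : ℝ →L[ℝ] E) 1 = v

variable (I I') in
/-- The tangent map of `f` at `x`, as a map between the model vector spaces. -/
def tangentAt (f : M → M') (x : M) : E →L[ℝ] E' := mfderiv I I' f x

theorem mem_tangentSet {N : Set M} {x : M} {v : E} :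
    v ∈ tangentSet I N x ↔ ∃ γ : ℝ → M, HasVelocity I γ x v ∧ ∀ᶠ t in 𝓝 (0 : ℝ), γ t ∈ N :=
  ⟨fun ⟨γ, h1, h2, h3, h4⟩ => ⟨γ, ⟨h1, h3, h4⟩, h2⟩,
    fun ⟨γ, ⟨h1, h3, h4⟩, h2⟩ => ⟨γ, h1, h2, h3, h4⟩⟩

namespace HasVelocity

variable {γ δ : ℝ → M} {x : M} {v w : E}

/-- The device by which every groupoid identity is differentiated: evaluate both sides along a curve
and compare velocities. -/
theorem unique {y : M} (h : HasVelocity I γ x v) (h' : HasVelocity I δ y w) (e : γ =ᶠ[𝓝 0] δ) :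
    v = w := by
  obtain ⟨_, _, rfl⟩ := h
  obtain ⟨_, _, rfl⟩ := h'
  exact congrArg (fun L : ℝ →L[ℝ] E => L 1) e.mfderiv_eq

/-- Since the curve stays in `s` near `0`, any derivative `D` within `s` computes the velocity;
uniqueness of `D` is not needed. -/
theorem compWithin {f : M → M'} {s : Set M} {D : E →L[ℝ] E'} (h : HasVelocity I γ x v)
    (hs : ∀ᶠ t in 𝓝 0, γ t ∈ s) (hf : ContMDiffWithinAt I I' ∞ f s x)
    (hD : HasMFDerivWithinAt I I' f s x D) : HasVelocity I' (fun t => f (γ t)) (f x) (D v) := by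
  obtain ⟨rfl, h2, rfl⟩ := h
  have hs' : γ ⁻¹' s ∈ 𝓝 (0 : ℝ) := hs
  have hc : ContMDiffWithinAt 𝓘(ℝ, ℝ) I' ∞ (f ∘ γ) (γ ⁻¹' s) 0 :=
    hf.comp (0 : ℝ) h2.contMDiffWithinAt (fun t ht => ht)
  refine ⟨rfl, hc.contMDiffAt hs', ?_⟩
  have hg := (h2.mdifferentiableAt (by simp)).hasMFDerivAt
  have := (hD.comp (0 : ℝ) (hg.hasMFDerivWithinAt (s := γ ⁻¹' s)) (fun t ht => ht)).hasMFDerivAt hs'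
  have h3 := this.mfderiv
  exact congrArg (fun L : ℝ →L[ℝ] E' => L 1) h3

theorem comp {f : M → M'} (h : HasVelocity I γ x v) (hf : ContMDiffAt I I' ∞ f x) :
    HasVelocity I' (fun t => f (γ t)) (f x) (tangentAt I I' f x v) :=
  h.compWithin (s := univ) (by simp) hf.contMDiffWithinAt
    (hf.mdifferentiableAt (by simp)).hasMFDerivAt.hasMFDerivWithinAt

theorem continuousAt (h : HasVelocity I γ x v) : ContinuousAt γ 0 := h.contMDiffAt.continuousAt

theorem prodMk {γ' : ℝ → M'} {x' : M'} {v' : E'} (h : HasVelocity I γ x v)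
    (h' : HasVelocity I' γ' x' v') :
    HasVelocity (I.prod I') (fun t => (γ t, γ' t)) (x, x') (v, v') := by
  obtain ⟨rfl, h2, rfl⟩ := h
  obtain ⟨rfl, h2', rfl⟩ := h'
  refine ⟨rfl, h2.prodMk h2', ?_⟩
  have := (((h2.mdifferentiableAt (by simp)).hasMFDerivAt).prodMk
    ((h2'.mdifferentiableAt (by simp)).hasMFDerivAt)).mfderiv
  exact congrArg (fun L : ℝ →L[ℝ] E × E' => L 1) this

theorem fst {γ : ℝ → M × M'} {x : M × M'} {v : E × E'} (h : HasVelocity (I.prod I') γ x v) :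
    HasVelocity I (fun t => (γ t).1) x.1 v.1 := by
  have := h.comp (I' := I) (f := Prod.fst) contMDiffAt_fst
  rwa [show tangentAt (I.prod I') I Prod.fst x = ContinuousLinearMap.fst ℝ E E' from
    mfderiv_fst] at this

theorem snd {γ : ℝ → M × M'} {x : M × M'} {v : E × E'} (h : HasVelocity (I.prod I') γ x v) :
    HasVelocity I' (fun t => (γ t).2) x.2 v.2 := by
  have := h.comp (I' := I') (f := Prod.snd) contMDiffAt_snd
  rwa [show tangentAt (I.prod I') I' Prod.snd x = ContinuousLinearMap.snd ℝ E E' from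
    mfderiv_snd] at this

theorem const (x : M) : HasVelocity I (fun _ => x) x 0 := by
  refine ⟨rfl, contMDiffAt_const, ?_⟩
  exact congrArg (fun L : ℝ →L[ℝ] E => L 1) (mfderiv_const (I := 𝓘(ℝ, ℝ)) (I' := I) (c := x))

theorem of_hasDerivAt {γ : ℝ → E} {v : E} (h : ContDiffAt ℝ ∞ γ 0) (hv : HasDerivAt γ v 0) :
    HasVelocity 𝓘(ℝ, E) γ (γ 0) v := by
  refine ⟨rfl, h.contMDiffAt, ?_⟩
  have h2 := congrArg (fun L : ℝ →L[ℝ] E => L 1) hv.hasFDerivAt.hasMFDerivAt.mfderiv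
  exact h2.trans (by simp)

theorem contDiffAt {γ : ℝ → E} {a v : E} (h : HasVelocity 𝓘(ℝ, E) γ a v) : ContDiffAt ℝ ∞ γ 0 :=
  h.contMDiffAt.contDiffAt

theorem hasDerivAt {γ : ℝ → E} {a v : E} (h : HasVelocity 𝓘(ℝ, E) γ a v) : HasDerivAt γ v 0 := by
  have h2 : (fderiv ℝ γ 0) 1 = v := by rw [← mfderiv_eq_fderiv]; exact h.velocity
  rw [← h2]
  exact (h.contDiffAt.differentiableAt (by simp)).hasFDerivAt.hasDerivAt

theorem line (a v : E) : HasVelocity 𝓘(ℝ, E) (fun t : ℝ => a + t • v) a v := by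
  have h : HasVelocity 𝓘(ℝ, E) (fun t : ℝ => a + t • v) (a + (0 : ℝ) • v) v := by
    apply of_hasDerivAt
    · fun_prop
    · simpa using ((hasDerivAt_id (0 : ℝ)).smul_const v).const_add a
  simpa using h

end HasVelocity

theorem tangentAt_comp {E'' : Type*} [NormedAddCommGroup E''] [NormedSpace ℝ E'']
    {H'' : Type*} [TopologicalSpace H''] {I'' : ModelWithCorners ℝ E'' H''}
    {M'' : Type*} [TopologicalSpace M''] [ChartedSpace H'' M''] {f : M → M'} {g : M' → M''} {x : M}
    (hg : ContMDiffAt I' I'' ∞ g (f x)) (hf : ContMDiffAt I I' ∞ f x) :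
    tangentAt I I'' (fun y => g (f y)) x = (tangentAt I' I'' g (f x)).comp (tangentAt I I' f x) :=
  mfderiv_comp x (hg.mdifferentiableAt (by simp)) (hf.mdifferentiableAt (by simp))

theorem tangentAt_congr {f g : M → M'} {x : M} (h : f =ᶠ[𝓝 x] g) :
    tangentAt I I' f x = tangentAt I I' g x :=
  h.mfderiv_eq

/-! ### Curves and local equations obtained from charts. -/

section Chart

variable {φ : OpenPartialHomeomorph M H}

theorem contMDiffAt_extend_symm [I.Boundaryless] (hφ : φ ∈ IsManifold.maximalAtlas I ∞ M) {u : E}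
    (hu : u ∈ (φ.extend I).target) : ContMDiffAt 𝓘(ℝ, E) I ∞ (φ.extend I).symm u := by
  have ht : (φ.extend I).target ∈ 𝓝 u := (φ.isOpen_extend_target (I := I)).mem_nhds hu
  have hs := contMDiffOn_extend_symm (I := I) hφ
  rw [← φ.extend_target'] at hs
  exact (hs u hu).contMDiffAt ht

theorem contMDiffAt_extend_of_mem (hφ : φ ∈ IsManifold.maximalAtlas I ∞ M) {x : M}
    (hx : x ∈ φ.source) : ContMDiffAt I 𝓘(ℝ, E) ∞ (φ.extend I) x :=
  (OpenPartialHomeomorph.contMDiffOn_extend hφ x hx).contMDiffAt (φ.open_source.mem_nhds hx)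

variable [I.Boundaryless]

theorem tangentAt_extend_symm_comp (hφ : φ ∈ IsManifold.maximalAtlas I ∞ M) {x : M}
    (hx : x ∈ φ.source) :
    (tangentAt 𝓘(ℝ, E) I (φ.extend I).symm (φ.extend I x)).comp
      (tangentAt I 𝓘(ℝ, E) (φ.extend I) x) = ContinuousLinearMap.id ℝ E := by
  have hx' : x ∈ (φ.extend I).source := by rwa [φ.extend_source]
  rw [← tangentAt_comp (contMDiffAt_extend_symm hφ ((φ.extend I).map_source hx'))
    (contMDiffAt_extend_of_mem hφ hx)]
  have : (fun y => (φ.extend I).symm (φ.extend I y)) =ᶠ[𝓝 x] id := by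
    filter_upwards [φ.open_source.mem_nhds hx] with y hy
    exact (φ.extend I).left_inv (by rwa [φ.extend_source])
  rw [tangentAt_congr this]
  exact mfderiv_id

theorem exists_hasVelocity [IsManifold I ∞ M] (x : M) (v : E) :
    ∃ γ : ℝ → M, HasVelocity I γ x v := by
  have hφ := IsManifold.chart_mem_maximalAtlas (I := I) (n := ∞) x
  have hx := mem_chart_source H x
  have hx' : x ∈ ((chartAt H x).extend I).source := by rwa [OpenPartialHomeomorph.extend_source]
  have h := (HasVelocity.line ((chartAt H x).extend I x)
    (tangentAt I 𝓘(ℝ, E) ((chartAt H x).extend I) x v)).comp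
      (contMDiffAt_extend_symm hφ (PartialEquiv.map_source _ hx'))
  have e := congrArg (fun L : E →L[ℝ] E => L v) (tangentAt_extend_symm_comp hφ hx)
  simp only [ContinuousLinearMap.comp_apply, ContinuousLinearMap.id_apply] at e
  rw [e, PartialEquiv.left_inv _ hx'] at h
  exact ⟨_, h⟩

/-- A covector which vanishes on the tangent space of a submanifold is the differential of a
local equation of the submanifold. -/
theorem IsSubmanifold.exists_local_equation {N : Set M} (hN : IsSubmanifold I N) {x : M}
    (hx : x ∈ N) (ζ : E →L[ℝ] ℝ) (hζ : ∀ v ∈ tangentSet I N x, ζ v = 0) :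
    ∃ (U : Set M) (f : M → ℝ), IsOpen U ∧ x ∈ U ∧ ContMDiffOn I 𝓘(ℝ, ℝ) ∞ f U ∧
      (∀ y ∈ N ∩ U, f y = 0) ∧ differentialAt I f x = ζ := by
  obtain ⟨φ, hφ, hxφ, W, hW⟩ := hN x hx
  have hx' : x ∈ (φ.extend I).source := by rwa [φ.extend_source]
  have hxt := (φ.extend I).map_source hx'
  set B := tangentAt 𝓘(ℝ, E) I (φ.extend I).symm (φ.extend I x) with hB
  have hsm : ContMDiff 𝓘(ℝ, E) 𝓘(ℝ, ℝ) ∞ (fun u : E => (ζ.comp B) (u - φ.extend I x)) := by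
    rw [contMDiff_iff_contDiff]; fun_prop
  refine ⟨φ.source, fun y => (ζ.comp B) (φ.extend I y - φ.extend I x), φ.open_source, hxφ,
    fun y hy => (hsm.contMDiffAt.comp y (contMDiffAt_extend_of_mem hφ hy)).contMDiffWithinAt,
    fun y hy => ?_, ?_⟩
  -- The line of direction `w ∈ W` stays in the slice, so it gives a curve in `N` with velocity `B
  -- w`; hence `ζ ∘ B` vanishes on `W`.
  · apply hζ
    have hw := (hW y hy.2).1 hy.1
    set w := φ.extend I y - φ.extend I x
    have hl := HasVelocity.line (φ.extend I x) w
    have hc := hl.comp (contMDiffAt_extend_symm hφ hxt)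
    rw [PartialEquiv.left_inv _ hx'] at hc
    refine (mem_tangentSet (E := E)).2 ⟨_, hc, ?_⟩
    have ht : (φ.extend I).target ∈ 𝓝 (φ.extend I x + (0 : ℝ) • w) := by
      simpa using (φ.isOpen_extend_target (I := I)).mem_nhds hxt
    filter_upwards [hl.continuousAt.preimage_mem_nhds ht] with t ht
    have hs := (φ.extend I).map_target ht
    rw [φ.extend_source] at hs
    rw [hW _ hs, PartialEquiv.right_inv _ ht, add_sub_cancel_left]
    exact W.smul_mem t hw
  · have h1 := tangentAt_comp (f := φ.extend I) (x := x) hsm.contMDiffAt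
      (contMDiffAt_extend_of_mem hφ hxφ)
    have h2 : tangentAt 𝓘(ℝ, E) 𝓘(ℝ, ℝ) (fun u : E => (ζ.comp B) (u - φ.extend I x))
        (φ.extend I x) = ζ.comp B := by
      have : HasFDerivAt (fun u : E => (ζ.comp B) (u - φ.extend I x)) (ζ.comp B) (φ.extend I x) := by
        have := (ζ.comp B).hasFDerivAt.comp (φ.extend I x)
          ((hasFDerivAt_id (φ.extend I x)).sub_const (φ.extend I x))
        exact this
      exact this.hasMFDerivAt.mfderiv
    rw [h2, ContinuousLinearMap.comp_assoc, tangentAt_extend_symm_comp hφ hxφ,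
      ContinuousLinearMap.comp_id] at h1
    exact h1

end Chart

/-! ### Lifting curves through submersions; images of embeddings. -/

section Submersion

/-- Curves lift through a submersion, with a prescribed velocity. -/
theorem Manifold.IsSubmersion.exists_lift [I.Boundaryless] {f : M → M'}
    (hf : Manifold.IsSubmersion I I' ∞ f) {x : M} {v : E} {c : ℝ → M'}
    (hc : HasVelocity I' c (f x) (tangentAt I I' f x v)) :
    ∃ γ : ℝ → M, HasVelocity I γ x v ∧ ∀ᶠ t in 𝓝 0, f (γ t) = c t := by
  have h := hf.isSubmersionAt x
  set φ := h.domChart.extend I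
  set ψ := h.codChart.extend I'
  set A := tangentAt I 𝓘(ℝ, E) φ x with hA
  have hxs := h.mem_domChart_source
  have hys := h.mem_codChart_source
  have hx' : x ∈ φ.source := by rwa [h.domChart.extend_source]
  have hy' : f x ∈ ψ.source := by rwa [h.codChart.extend_source]
  have hxt := φ.map_source hx'
  have hφ := h.domChart_mem_maximalAtlas
  have hψ := h.codChart_mem_maximalAtlas
  have key : ∀ u ∈ φ.target, ψ (f (φ.symm u)) = (h.equiv u).1 := fun u hu => h.writtenInCharts hu
  have h1 := hc.comp (contMDiffAt_extend_of_mem hψ hys)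
  -- In adapted charts `f` is the projection `E' × complement → E'`: the lift has the given curve as
  -- first component and a line with the required velocity as second.
  have h3 : HasVelocity 𝓘(ℝ, E)
      (fun t => h.equiv.symm (ψ (c t), (h.equiv (φ x)).2 + t • (h.equiv (A v)).2)) (φ x) (A v) := by
    have hd := h1.hasDerivAt.prodMk
      (HasVelocity.line (h.equiv (φ x)).2 (h.equiv (A v)).2).hasDerivAt
    have hl := (h.equiv.symm : (E' × h.complement) →L[ℝ] E).hasFDerivAt.comp_hasDerivAt (0 : ℝ) hd
    have hcd : ContDiffAt ℝ ∞
        (fun t => h.equiv.symm (ψ (c t), (h.equiv (φ x)).2 + t • (h.equiv (A v)).2)) 0 :=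
      h.equiv.symm.contDiff.contDiffAt.comp (0 : ℝ) (h1.contDiffAt.prodMk (by fun_prop))
    have hres := HasVelocity.of_hasDerivAt hcd hl
    have hA1 : tangentAt I' 𝓘(ℝ, E') ψ (f x) (tangentAt I I' f x v) = (h.equiv (A v)).1 := by
      have e1 := tangentAt_comp (contMDiffAt_extend_of_mem hψ hys)
        (hf.contMDiff.contMDiffAt (x := x))
      have e2 : (fun y => ψ (f y)) =ᶠ[𝓝 x]
          (fun y => ((ContinuousLinearMap.fst ℝ E' h.complement).comp
            (h.equiv : E →L[ℝ] E' × h.complement)) (φ y)) := by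
        filter_upwards [h.domChart.open_source.mem_nhds hxs] with y hy
        rw [← h.domChart.extend_source (I := I)] at hy
        have := key _ (φ.map_source hy)
        rw [φ.left_inv hy] at this
        exact this
      rw [tangentAt_congr e2, tangentAt_comp (ContinuousLinearMap.contMDiffAt _)
        (contMDiffAt_extend_of_mem hφ hxs)] at e1
      have e3 := congrArg (fun L : E →L[ℝ] E' => L v) e1
      refine e3.symm.trans ?_
      have e4 : tangentAt 𝓘(ℝ, E) 𝓘(ℝ, E') ((ContinuousLinearMap.fst ℝ E' h.complement).comp
          (h.equiv : E →L[ℝ] E' × h.complement)) (φ x) = (ContinuousLinearMap.fst ℝ E'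
          h.complement).comp (h.equiv : E →L[ℝ] E' × h.complement) :=
        (ContinuousLinearMap.hasMFDerivAt _).mfderiv
      exact congrArg (fun L : E →L[ℝ] E' => L (A v)) e4
    have hz : ψ (c 0) = (h.equiv (φ x)).1 := by
      rw [hc.map_zero, ← key _ hxt, φ.left_inv hx']
    rw [hA1] at hres
    simpa [hz] using hres
  have h4 := h3.comp (contMDiffAt_extend_symm hφ hxt)
  rw [φ.left_inv hx', ← ContinuousLinearMap.comp_apply, tangentAt_extend_symm_comp hφ hxs] at h4
  refine ⟨_, h4, ?_⟩
  have hz : h.equiv.symm (ψ (c 0), (h.equiv (φ x)).2 + (0 : ℝ) • (h.equiv (A v)).2) = φ x :=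
    h3.map_zero
  have hct : ∀ᶠ t in 𝓝 (0 : ℝ), c t ∈ h.codChart.source := by
    apply hc.continuousAt.preimage_mem_nhds
    rw [hc.map_zero]
    exact h.codChart.open_source.mem_nhds hys
  have hut := h3.continuousAt.preimage_mem_nhds (t := φ.target) (by
    rw [hz]; exact h.domChart.isOpen_extend_target.mem_nhds hxt)
  filter_upwards [hct, hut] with t ht ht'
  have hk := key _ ht'
  rw [ContinuousLinearEquiv.apply_symm_apply] at hk
  refine ψ.injOn ?_ ?_ hk
  · rw [h.codChart.extend_source]
    apply h.source_subset_preimage_source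
    have := φ.map_target ht'
    rwa [h.domChart.extend_source] at this
  · rwa [h.codChart.extend_source]

theorem Manifold.IsSubmersion.tangentSet_fiber [I.Boundaryless] {f : M → M'}
    (hf : Manifold.IsSubmersion I I' ∞ f) (x : M) :
    tangentSet I (f ⁻¹' {f x}) x = {v : E | tangentAt I I' f x v = 0} := by
  ext v
  refine (mem_tangentSet (E := E)).trans ⟨fun ⟨γ, h, hγ⟩ => ?_, fun hv => ?_⟩
  · exact (h.comp hf.contMDiff.contMDiffAt).unique (HasVelocity.const (f x)) hγ
  · obtain ⟨γ, h, hγ⟩ := hf.exists_lift (E := E) (x := x) (v := v) (c := fun _ => f x) (by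
      rw [show tangentAt (E := E) I I' f x v = 0 from hv]; exact HasVelocity.const (f x))
    exact ⟨γ, h, hγ⟩

/-- The image of a smooth embedding is a submanifold. -/
theorem Manifold.IsSmoothEmbedding.isSubmanifold_range [I'.Boundaryless] {f : M' → M}
    (hf : Manifold.IsSmoothEmbedding I' I ∞ f) : IsSubmanifold I (range f) := by
  rintro _ ⟨p, rfl⟩
  have h := hf.isImmersion.isImmersionAt p
  set φ := h.codChart.extend I
  set ψ := h.domChart.extend I'
  have key : ∀ u ∈ ψ.target, φ (f (ψ.symm u)) = h.equiv (u, 0) := fun u hu => h.writtenInCharts hu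
  have hψs : ψ.source = h.domChart.source := h.domChart.extend_source
  have hφs : φ.source = h.codChart.source := h.codChart.extend_source
  have key' : ∀ q ∈ h.domChart.source, φ (f q) = h.equiv (ψ q, 0) := fun q hq => by
    rw [← hψs] at hq
    rw [← key _ (ψ.map_source hq), ψ.left_inv hq]
  -- The chart is shrunk twice: `V` discards the points of the range coming from outside the domain
  -- chart (here the embedding property is used), and `O` ensures that every slice point `ψ p + w`
  -- lies in the target of `ψ`.
  obtain ⟨V, hV, hVe⟩ := hf.isEmbedding.isOpen_iff.1 h.domChart.open_source
  set O : Set M := φ.source ∩ φ ⁻¹' {u | (h.equiv.symm u).1 ∈ ψ.target} with hO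
  have hOo : IsOpen O := by
    refine (h.codChart.continuousOn_extend (I := I)).isOpen_inter_preimage ?_ ?_
    · rw [h.codChart.extend_source]; exact h.codChart.open_source
    · exact h.domChart.isOpen_extend_target.preimage (by fun_prop)
  have hres : (h.codChart.restr (V ∩ O)).source = h.codChart.source ∩ (V ∩ O) := by
    rw [OpenPartialHomeomorph.restr_source, (hV.inter hOo).interior_eq]
  refine ⟨h.codChart.restr (V ∩ O), restr_mem_maximalAtlas _ h.codChart_mem_maximalAtlas
    (hV.inter hOo), ?_, (LinearMap.range (h.equiv.toLinearMap.comp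
      (LinearMap.inl ℝ E' h.complement))), ?_⟩
  · rw [hres]
    refine ⟨h.mem_codChart_source, ?_, ?_, ?_⟩
    · have : p ∈ f ⁻¹' V := hVe ▸ h.mem_domChart_source
      exact this
    · rw [hφs]; exact h.mem_codChart_source
    · have : (h.equiv.symm (φ (f p))).1 ∈ ψ.target := by
        rw [key' p h.mem_domChart_source, ContinuousLinearEquiv.symm_apply_apply]
        exact ψ.map_source (hψs ▸ h.mem_domChart_source)
      exact this
  · intro y hy
    rw [hres] at hy
    obtain ⟨hy1, hyV, hyO1, hyO2⟩ := hy
    change y ∈ range f ↔ φ y - φ (f p) ∈ _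
    rw [key' p h.mem_domChart_source, LinearMap.mem_range]
    constructor
    · rintro ⟨q, rfl⟩
      have hq : q ∈ h.domChart.source := hVe ▸ (show q ∈ f ⁻¹' V from hyV)
      refine ⟨ψ q - ψ p, ?_⟩
      rw [key' q hq, ← map_sub]
      simp
    · rintro ⟨w, hw⟩
      have hw' : φ y = h.equiv (ψ p + w, 0) := by
        have : φ y = h.equiv (w, 0) + h.equiv (ψ p, 0) := by
          rw [eq_comm, ← eq_sub_iff_add_eq]; exact hw
        rw [this, ← map_add]; simp [add_comm]
      have ht : ψ p + w ∈ ψ.target := by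
        have : (h.equiv.symm (φ y)).1 ∈ ψ.target := hyO2
        rwa [hw', ContinuousLinearEquiv.symm_apply_apply] at this
      have hm := ψ.map_target ht
      rw [hψs] at hm
      refine ⟨ψ.symm (ψ p + w), φ.injOn ?_ hyO1 ?_⟩
      · rw [hφs]; exact h.source_subset_preimage_source hm
      · rw [key _ ht, hw']

end Submersion

end Velocity

/-! ### Alternating forms, and the form and bivector on the triple product. -/

section TripleProducts

variable {E : Type*} [NormedAddCommGroup E] [NormedSpace ℝ E]
  {H : Type*} [TopologicalSpace H] {I : ModelWithCorners ℝ E H}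
  {M : Type*} [TopologicalSpace M] [ChartedSpace H M]

theorem alternating_swap (σ : E [⋀^Fin 2]→L[ℝ] ℝ) (v w : E) : σ ![w, v] = -σ ![v, w] := by
  have := σ.toAlternatingMap.map_swap ![v, w] (i := 0) (j := 1) (by decide)
  rw [show (![v, w] ∘ Equiv.swap (0 : Fin 2) 1) = ![w, v] by
    ext i; fin_cases i <;> rfl] at this
  exact this

theorem alternating_zero_left (σ : E [⋀^Fin 2]→L[ℝ] ℝ) (w : E) : σ ![0, w] = 0 := by
  simpa using negInterior_apply σ 0 w

theorem alternating_zero_right (σ : E [⋀^Fin 2]→L[ℝ] ℝ) (v : E) : σ ![v, 0] = 0 := by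
  simpa using negInterior_apply σ v 0

theorem alternating_sub_right (σ : E [⋀^Fin 2]→L[ℝ] ℝ) (v w w' : E) :
    σ ![v, w - w'] = σ ![v, w] - σ ![v, w'] := by
  have h := map_sub (negInterior σ v) w w'
  simp only [negInterior_apply] at h
  linarith

theorem alternating_neg_neg (σ : E [⋀^Fin 2]→L[ℝ] ℝ) (v w : E) : σ ![-v, -w] = σ ![v, w] := by
  have h1 := negInterior_apply σ (-v) (-w)
  have h2 := negInterior_apply σ v w
  simp only [map_neg, neg_apply, neg_neg] at h1
  linarith

theorem negInterior_surjective [FiniteDimensional ℝ E] (σ : E [⋀^Fin 2]→L[ℝ] ℝ)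
    (hσ : ∀ v : E, v ≠ 0 → ∃ w : E, σ ![v, w] ≠ 0) : Function.Surjective (negInterior σ) := by
  have hinj : Function.Injective (negInterior σ).toLinearMap := by
    refine (injective_iff_map_eq_zero _).2 fun v hv => ?_
    by_contra hne
    obtain ⟨w, hw⟩ := hσ v hne
    have := negInterior_apply σ v w
    rw [show negInterior σ v = 0 from hv, zero_apply] at this
    exact hw (neg_eq_zero.1 this.symm)
  have hdim : Module.finrank ℝ E = Module.finrank ℝ (E →L[ℝ] ℝ) := by
    rw [← (LinearMap.toContinuousLinearMap (𝕜 := ℝ) (E := E) (F' := ℝ)).finrank_eq]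
    exact (Subspace.dual_finrank_eq (K := ℝ) (V := E)).symm
  exact (LinearMap.injective_iff_surjective_of_finrank_eq_finrank hdim).1 hinj

theorem comp_vec2 {E' : Type*} [NormedAddCommGroup E'] [NormedSpace ℝ E']
    (σ : E' [⋀^Fin 2]→L[ℝ] ℝ) (L : E →L[ℝ] E') (v w : E) :
    σ.compContinuousLinearMap L ![v, w] = σ ![L v, L w] := by
  change σ (L ∘ ![v, w]) = _
  congr 1
  ext i; fin_cases i <;> rfl

/-- The value of a `2`-form at a point, as a form on the model vector space. -/
def TwoForm.valueAt (Ω : TwoForm I M) (x : M) : E [⋀^Fin 2]→L[ℝ] ℝ := Ω x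

/-- The value of a bivector field at a point, as a bivector of the model vector space. -/
def BivectorField.valueAt (P : BivectorField I M) (x : M) : (E →L[ℝ] ℝ) [⋀^Fin 2]→L[ℝ] ℝ := P x

theorem tripleForm_apply (Ω : TwoForm I M) (x y z : M) (a b : E × E × E) :
    tripleForm I Ω (x, y, z) ![a, b]
      = TwoForm.valueAt Ω x ![a.1, b.1] + TwoForm.valueAt Ω y ![a.2.1, b.2.1]
        - TwoForm.valueAt Ω z ![a.2.2, b.2.2] := by
  have h1 : tangentAt (I.prod (I.prod I)) I (fun p : M × M × M => p.1) (x, y, z)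
      = ContinuousLinearMap.fst ℝ E (E × E) := mfderiv_fst
  have h : tangentAt (I.prod (I.prod I)) (I.prod I) (fun p : M × M × M => p.2) (x, y, z)
      = ContinuousLinearMap.snd ℝ E (E × E) := mfderiv_snd
  have h2 : tangentAt (I.prod (I.prod I)) I (fun p : M × M × M => p.2.1) (x, y, z)
      = (ContinuousLinearMap.fst ℝ E E).comp (ContinuousLinearMap.snd ℝ E (E × E)) := by
    rw [← h]
    exact (tangentAt_comp (g := Prod.fst) contMDiffAt_fst contMDiffAt_snd).trans
      (congrArg (fun L : E × E →L[ℝ] E => L.comp _) mfderiv_fst)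
  have h3 : tangentAt (I.prod (I.prod I)) I (fun p : M × M × M => p.2.2) (x, y, z)
      = (ContinuousLinearMap.snd ℝ E E).comp (ContinuousLinearMap.snd ℝ E (E × E)) := by
    rw [← h]
    exact (tangentAt_comp (g := Prod.snd) contMDiffAt_snd contMDiffAt_snd).trans
      (congrArg (fun L : E × E →L[ℝ] E => L.comp _) mfderiv_snd)
  have e1 := comp_vec2 (TwoForm.valueAt Ω x)
    (tangentAt (I.prod (I.prod I)) I (fun p : M × M × M => p.1) (x, y, z)) a b
  have e2 := comp_vec2 (TwoForm.valueAt Ω y)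
    (tangentAt (I.prod (I.prod I)) I (fun p : M × M × M => p.2.1) (x, y, z)) a b
  have e3 := comp_vec2 (TwoForm.valueAt Ω z)
    (tangentAt (I.prod (I.prod I)) I (fun p : M × M × M => p.2.2) (x, y, z)) a b
  have e := congrArg₂ (· - ·) (congrArg₂ (· + ·) e1 e2) e3
  refine Eq.trans ?_ (e.trans ?_)
  · rfl
  · rw [h1, h2, h3]; rfl

/-- The covector on a triple product with components `a`, `b`, `c`. -/
def tripleCovector (a b c : E →L[ℝ] ℝ) : E × E × E →L[ℝ] ℝ := a.coprod (b.coprod c)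

theorem tripleBivector_apply (P : BivectorField I M) (x y z : M)
    (a b c a' b' c' : E →L[ℝ] ℝ) :
    tripleBivector I P (x, y, z) ![tripleCovector a b c, tripleCovector a' b' c']
      = BivectorField.valueAt P x ![a, a'] + BivectorField.valueAt P y ![b, b']
        - BivectorField.valueAt P z ![c, c'] := by
  have h1 : tangentAt I (I.prod (I.prod I)) (fun x' : M => (x', y, z)) x
      = (ContinuousLinearMap.id ℝ E).prod (0 : E →L[ℝ] E × E) :=
    ((hasMFDerivAt_id x).prodMk (hasMFDerivAt_const (y, z) x)).mfderiv
  have h2 : tangentAt I (I.prod (I.prod I)) (fun y' : M => (x, y', z)) y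
      = (0 : E →L[ℝ] E).prod ((ContinuousLinearMap.id ℝ E).prod (0 : E →L[ℝ] E)) :=
    ((hasMFDerivAt_const x y).prodMk
      ((hasMFDerivAt_id y).prodMk (hasMFDerivAt_const z y))).mfderiv
  have h3 : tangentAt I (I.prod (I.prod I)) (fun z' : M => (x, y, z')) z
      = (0 : E →L[ℝ] E).prod ((0 : E →L[ℝ] E).prod (ContinuousLinearMap.id ℝ E)) :=
    ((hasMFDerivAt_const x z).prodMk
      ((hasMFDerivAt_const y z).prodMk (hasMFDerivAt_id z))).mfderiv
  have e1 := comp_vec2 (BivectorField.valueAt P x) (ContinuousLinearMap.precomp ℝ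
    (tangentAt I (I.prod (I.prod I)) (fun x' : M => (x', y, z)) x))
    (tripleCovector a b c) (tripleCovector a' b' c')
  have e2 := comp_vec2 (BivectorField.valueAt P y) (ContinuousLinearMap.precomp ℝ
    (tangentAt I (I.prod (I.prod I)) (fun y' : M => (x, y', z)) y))
    (tripleCovector a b c) (tripleCovector a' b' c')
  have e3 := comp_vec2 (BivectorField.valueAt P z) (ContinuousLinearMap.precomp ℝ
    (tangentAt I (I.prod (I.prod I)) (fun z' : M => (x, y, z')) z))
    (tripleCovector a b c) (tripleCovector a' b' c')
  have e := congrArg₂ (· - ·) (congrArg₂ (· + ·) e1 e2) e3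
  refine Eq.trans ?_ (e.trans ?_)
  · rfl
  · rw [h1, h2, h3]
    have k1 : ∀ a b c : E →L[ℝ] ℝ, (tripleCovector a b c).comp
        ((ContinuousLinearMap.id ℝ E).prod (0 : E →L[ℝ] E × E)) = a := by
      intro a b c; ext v; simp [tripleCovector]
    have k2 : ∀ a b c : E →L[ℝ] ℝ, (tripleCovector a b c).comp
        ((0 : E →L[ℝ] E).prod ((ContinuousLinearMap.id ℝ E).prod (0 : E →L[ℝ] E))) = b := by
      intro a b c; ext v; simp [tripleCovector]
    have k3 : ∀ a b c : E →L[ℝ] ℝ, (tripleCovector a b c).comp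
        ((0 : E →L[ℝ] E).prod ((0 : E →L[ℝ] E).prod (ContinuousLinearMap.id ℝ E))) = c := by
      intro a b c; ext v; simp [tripleCovector]
    simp only [ContinuousLinearMap.precomp_apply, k1, k2, k3]

/-- The bivector of a Poisson manifold vanishes on the conormal spaces of a coisotropic
submanifold. -/
theorem IsCoisotropicSubmanifold.apply_eq_zero [I.Boundaryless] {P : BivectorField I M}
    {N : Set M} (h : IsCoisotropicSubmanifold I P N) {x : M} (hx : x ∈ N) {ζ η : E →L[ℝ] ℝ}
    (hζ : ∀ v ∈ tangentSet I N x, ζ v = 0) (hη : ∀ v ∈ tangentSet I N x, η v = 0) :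
    BivectorField.valueAt P x ![ζ, η] = 0 := by
  obtain ⟨U, f, hU, hxU, hf, hf0, rfl⟩ := h.1.exists_local_equation hx ζ hζ
  obtain ⟨V, g, hV, hxV, hg, hg0, rfl⟩ := h.1.exists_local_equation hx η hη
  exact h.2 (U ∩ V) f g (hU.inter hV) (hf.mono inter_subset_left) (hg.mono inter_subset_right)
    (fun y hy => hf0 y ⟨hy.1, hy.2.1⟩) (fun y hy => hg0 y ⟨hy.1, hy.2.2⟩) x ⟨hx, hxU, hxV⟩

end TripleProducts

/-! ### Differentiating the groupoid identities. -/

section GroupoidTangent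

variable {E : Type*} [NormedAddCommGroup E] [NormedSpace ℝ E]
  {H : Type*} [TopologicalSpace H] {I : ModelWithCorners ℝ E H}
  {E₀ : Type*} [NormedAddCommGroup E₀] [NormedSpace ℝ E₀]
  {H₀ : Type*} [TopologicalSpace H₀] {I₀ : ModelWithCorners ℝ E₀ H₀}
  {Γ : Type*} [TopologicalSpace Γ] [ChartedSpace H Γ]
  {Γ₀ : Type*} [TopologicalSpace Γ₀] [ChartedSpace H₀ Γ₀]

namespace LieGroupoid

variable (G : LieGroupoid I I₀ Γ Γ₀)

/-- Comes from `assoc_defined` for the triple `ε(α(x))`, `x`, `y`: the bracketing `(ε(α(x)) x) y` is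
defined, hence so is the other one. -/
theorem target_mul {x y : Γ} (h : G.source x = G.target y) : G.target (G.mul x y) = G.target x := by
  have := (G.assoc_defined (G.unit (G.target x)) x y).2
    ⟨G.source_unit _, by rw [G.unit_mul]; exact h⟩
  rw [← this.2, G.source_unit]

theorem source_mul {x y : Γ} (h : G.source x = G.target y) : G.source (G.mul x y) = G.source y := by
  have := (G.assoc_defined x y (G.unit (G.source y))).1
    ⟨(G.target_unit _).symm, by rw [G.mul_unit]; exact h⟩
  rw [this.2, G.target_unit]

theorem inv_mul_cancel_left {x y : Γ} (h : G.source x = G.target y) :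
    G.mul (G.inv x) (G.mul x y) = y := by
  rw [G.assoc _ _ _ h (by rw [G.target_mul h, G.source_inv_eq_target]), G.inv_mul, h, G.unit_mul]

theorem inv_inv (x : Γ) : G.inv (G.inv x) = x := by
  have h := G.inv_mul_cancel_left (x := G.inv x) (y := x) (G.source_inv_eq_target x)
  rw [G.inv_mul] at h
  have h' := G.mul_unit (G.inv (G.inv x))
  rw [G.source_inv_eq_target, ← G.source_eq_target_inv] at h'
  rw [← h', h]

/-- The tangent map of the target map. -/
def dTarget (x : Γ) : E →L[ℝ] E₀ := tangentAt I I₀ G.target x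

/-- The tangent map of the source map. -/
def dSource (x : Γ) : E →L[ℝ] E₀ := tangentAt I I₀ G.source x

/-- The tangent map of the unit section. -/
def dUnit (u : Γ₀) : E₀ →L[ℝ] E := tangentAt I₀ I G.unit u

/-- The tangent map of the inverse map. -/
def dInv (x : Γ) : E →L[ℝ] E := tangentAt I I G.inv x

/-- A linear map which restricts to the tangent map of the product on the tangent space to the
submanifold of composable pairs. -/
def dMul (x y : Γ) : E × E →L[ℝ] E :=
  mfderivWithin (I.prod I) I (fun p : Γ × Γ => G.mul p.1 p.2)
    {p : Γ × Γ | G.source p.1 = G.target p.2} (x, y)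

variable {G} {γ δ : ℝ → Γ} {x y z : Γ} {X Y Z : E}

section

variable (G)

theorem velocity_target (h : HasVelocity I γ x X) :
    HasVelocity I₀ (fun t => G.target (γ t)) (G.target x) (G.dTarget x X) :=
  h.comp G.submersion_target.contMDiff.contMDiffAt

theorem velocity_source (h : HasVelocity I γ x X) :
    HasVelocity I₀ (fun t => G.source (γ t)) (G.source x) (G.dSource x X) :=
  h.comp G.submersion_source.contMDiff.contMDiffAt

theorem velocity_unit {c : ℝ → Γ₀} {u : Γ₀} {a : E₀} (h : HasVelocity I₀ c u a) :
    HasVelocity I (fun t => G.unit (c t)) (G.unit u) (G.dUnit u a) :=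
  h.comp G.embedding_unit.contMDiff.contMDiffAt

theorem velocity_inv (h : HasVelocity I γ x X) :
    HasVelocity I (fun t => G.inv (γ t)) (G.inv x) (G.dInv x X) :=
  h.comp G.inv.contMDiff.contMDiffAt

/-- Apart from linearity, this is all that is used about `dMul`; its values off the tangent space of
the composable pairs play no role. -/
theorem velocity_mul (h : HasVelocity I γ x X) (h' : HasVelocity I δ y Y)
    (hc : ∀ᶠ t in 𝓝 0, G.source (γ t) = G.target (δ t)) :
    HasVelocity I (fun t => G.mul (γ t) (δ t)) (G.mul x y) (G.dMul x y (X, Y)) := by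
  have h0 : G.source x = G.target y := by
    have := hc.self_of_nhds
    rwa [h.map_zero, h'.map_zero] at this
  have hm := G.contMDiffOn_mul (x, y) h0
  exact (h.prodMk h').compWithin (f := fun p : Γ × Γ => G.mul p.1 p.2) hc hm
    (hm.mdifferentiableWithinAt (by simp)).hasMFDerivWithinAt

theorem mem_graph_mul_unit (x : Γ) : (x, G.unit (G.source x), x) ∈ G.graph :=
  ⟨(G.target_unit _).symm, (G.mul_unit x).symm⟩

theorem mem_graph_unit_mul (x : Γ) : (G.unit (G.target x), x, x) ∈ G.graph :=
  ⟨G.source_unit _, (G.unit_mul x).symm⟩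

theorem mem_graph_inv (x : Γ) : (x, G.inv x, G.unit (G.target x)) ∈ G.graph :=
  ⟨G.source_eq_target_inv x, (G.mul_inv x).symm⟩

theorem mem_graph_unit (u : Γ₀) : (G.unit u, G.unit u, G.unit u) ∈ G.graph := by
  have := G.mem_graph_mul_unit (G.unit u)
  rwa [G.source_unit] at this

section Units

variable [IsManifold I₀ ∞ Γ₀] [I₀.Boundaryless]

theorem dTarget_dUnit (u : Γ₀) (a : E₀) : G.dTarget (G.unit u) (G.dUnit u a) = a := by
  obtain ⟨c, hc⟩ := exists_hasVelocity (I := I₀) u a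
  exact (G.velocity_target (G.velocity_unit hc)).unique hc
    (Eventually.of_forall fun t => G.target_unit _)

theorem dSource_dUnit (u : Γ₀) (a : E₀) : G.dSource (G.unit u) (G.dUnit u a) = a := by
  obtain ⟨c, hc⟩ := exists_hasVelocity (I := I₀) u a
  exact (G.velocity_source (G.velocity_unit hc)).unique hc
    (Eventually.of_forall fun t => G.source_unit _)

/-- The tangent space of the submanifold of units is the range of the tangent map of the unit
section. -/
theorem tangentSet_range_unit (u : Γ₀) :
    tangentSet I (range G.unit) (G.unit u) = (range (G.dUnit u) : Set E) := by
  ext v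
  refine (mem_tangentSet (E := E)).trans ⟨fun ⟨γ, h, hγ⟩ => ?_, ?_⟩
  -- A curve of units is fixed by `ε ∘ α`, so its velocity is the image of its own `α`-velocity.
  · refine ⟨G.dTarget (G.unit u) v, ?_⟩
    have h1 := G.velocity_target h
    rw [G.target_unit] at h1
    refine (G.velocity_unit h1).unique h (hγ.mono fun t ⟨w, hw⟩ => ?_)
    simp only [← hw, G.target_unit]
  · rintro ⟨a, rfl⟩
    obtain ⟨c, hc⟩ := exists_hasVelocity (I := I₀) u a
    exact ⟨_, G.velocity_unit hc, Eventually.of_forall fun t => mem_range_self _⟩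

end Units

variable [I.Boundaryless]

/-- Take any curve `γ` with velocity `X` and lift `β ∘ γ` through the submersion `α` with velocity
`Y`. -/
theorem exists_composable_velocity [IsManifold I ∞ Γ] (h : G.source x = G.target y)
    (h' : G.dSource x X = G.dTarget y Y) : ∃ γ δ : ℝ → Γ, HasVelocity I γ x X ∧
      HasVelocity I δ y Y ∧ ∀ᶠ t in 𝓝 0, G.source (γ t) = G.target (δ t) := by
  obtain ⟨γ, hγ⟩ := exists_hasVelocity (I := I) x X
  have hc := G.velocity_source hγ
  rw [h, h'] at hc
  obtain ⟨δ, hδ, e⟩ := G.submersion_target.exists_lift (v := Y) hc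
  exact ⟨γ, δ, hγ, hδ, e.mono fun t ht => ht.symm⟩

variable {G} in
/-- The tangent map of the product at `(x, u)`, where `u` is the unit at the source of `x`, on
vectors tangent to the fiber of the source map. -/
theorem dMul_unit_of_dSource_eq_zero {X : E} (h : G.dSource x X = 0) :
    G.dMul x (G.unit (G.source x)) (X, 0) = X := by
  obtain ⟨γ, hγ, e⟩ := mem_tangentSet.1 (show X ∈ tangentSet I (G.source ⁻¹' {G.source x}) x by
    rw [G.submersion_source.tangentSet_fiber]; exact h)
  have e' : ∀ᶠ t in 𝓝 0, G.source (γ t) = G.source x := e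
  exact (G.velocity_mul hγ (HasVelocity.const (G.unit (G.source x)))
    (e'.mono fun t ht => by rw [ht, G.target_unit])).unique hγ
    (e'.mono fun t ht => by simp only [← ht, G.mul_unit])

variable [IsManifold I ∞ Γ]

/-- Curves in the graph are composable pairs of curves together with their product. This turns both
hypotheses on the graph into linear algebra. -/
theorem mem_tangentSet_graph (h : G.source x = G.target y) (hz : z = G.mul x y) :
    ((X, Y, Z) : E × E × E) ∈ tangentSet (I.prod (I.prod I)) G.graph (x, y, z) ↔
      G.dSource x X = G.dTarget y Y ∧ Z = G.dMul x y (X, Y) := by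
  subst hz
  refine (mem_tangentSet (E := E × E × E)).trans ⟨fun ⟨γ, hγ, hm⟩ => ?_, fun ⟨h1, h2⟩ => ?_⟩
  · have hx := hγ.fst
    have hy := hγ.snd.fst
    have hz := hγ.snd.snd
    exact ⟨(G.velocity_source hx).unique (G.velocity_target hy) (hm.mono fun t ht => ht.1),
      hz.unique (G.velocity_mul hx hy (hm.mono fun t ht => ht.1)) (hm.mono fun t ht => ht.2)⟩
  · obtain ⟨γ, δ, hγ, hδ, e⟩ := G.exists_composable_velocity h h1
    have := hγ.prodMk (hδ.prodMk (G.velocity_mul hγ hδ e))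
    rw [← h2] at this
    exact ⟨_, this, e.mono fun t ht => ⟨ht, rfl⟩⟩

variable {G}

theorem dTarget_dMul (h : G.source x = G.target y) (h' : G.dSource x X = G.dTarget y Y) :
    G.dTarget (G.mul x y) (G.dMul x y (X, Y)) = G.dTarget x X := by
  obtain ⟨γ, δ, hγ, hδ, e⟩ := G.exists_composable_velocity h h'
  exact (G.velocity_target (G.velocity_mul hγ hδ e)).unique (G.velocity_target hγ)
    (e.mono fun t ht => G.target_mul ht)

theorem dSource_dMul (h : G.source x = G.target y) (h' : G.dSource x X = G.dTarget y Y) :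
    G.dSource (G.mul x y) (G.dMul x y (X, Y)) = G.dSource y Y := by
  obtain ⟨γ, δ, hγ, hδ, e⟩ := G.exists_composable_velocity h h'
  exact (G.velocity_source (G.velocity_mul hγ hδ e)).unique (G.velocity_source hδ)
    (e.mono fun t ht => G.source_mul ht)

/-- The derivative of `x⁻¹(xy) = y`. -/
theorem dMul_dInv_dMul (h : G.source x = G.target y) (h' : G.dSource x X = G.dTarget y Y) :
    G.dMul (G.inv x) (G.mul x y) (G.dInv x X, G.dMul x y (X, Y)) = Y := by
  obtain ⟨γ, δ, hγ, hδ, e⟩ := G.exists_composable_velocity h h'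
  refine (G.velocity_mul (G.velocity_inv hγ) (G.velocity_mul hγ hδ e) ?_).unique hδ
    (e.mono fun t ht => G.inv_mul_cancel_left ht)
  filter_upwards [e] with t ht
  rw [G.target_mul ht, G.source_inv_eq_target]

/-- The tangent map at `c` of the left translation by `c⁻¹` sends a vector tangent to the
fiber of the target map to a vector at the unit, which the left translation by `c` sends back. -/
theorem dMul_leftTranslate {c : Γ} {v : E} (hv : G.dTarget c v = 0) :
    G.dTarget (G.unit (G.source c)) (G.dMul (G.inv c) c (0, v)) = 0 ∧
      G.dMul c (G.unit (G.source c)) (0, G.dMul (G.inv c) c (0, v)) = v := by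
  have h := G.source_inv_eq_target c
  have h' : G.dSource (G.inv c) 0 = G.dTarget c v := by rw [map_zero, hv]
  have h1 := dTarget_dMul h h'
  have h2 := dMul_dInv_dMul h h'
  rw [map_zero] at h1 h2
  rw [G.inv_mul] at h1 h2
  rw [G.inv_inv] at h2
  exact ⟨h1, h2⟩

variable (G)

theorem dMul_dUnit {u : Γ₀} (h : G.source x = u) (X : E) :
    G.dMul x (G.unit u) (X, G.dUnit u (G.dSource x X)) = X := by
  subst h
  obtain ⟨γ, hγ⟩ := exists_hasVelocity (I := I) x X
  exact (G.velocity_mul hγ (G.velocity_unit (G.velocity_source hγ))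
    (Eventually.of_forall fun t => (G.target_unit _).symm)).unique hγ
    (Eventually.of_forall fun t => G.mul_unit _)

theorem dUnit_dMul {u : Γ₀} (h : G.target x = u) (X : E) :
    G.dMul (G.unit u) x (G.dUnit u (G.dTarget x X), X) = X := by
  subst h
  obtain ⟨γ, hγ⟩ := exists_hasVelocity (I := I) x X
  exact (G.velocity_mul (G.velocity_unit (G.velocity_target hγ)) hγ
    (Eventually.of_forall fun t => G.source_unit _)).unique hγ
    (Eventually.of_forall fun t => G.unit_mul _)

theorem dSource_dInv (x : Γ) (X : E) : G.dSource (G.inv x) (G.dInv x X) = G.dTarget x X := by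
  obtain ⟨γ, hγ⟩ := exists_hasVelocity (I := I) x X
  exact (G.velocity_source (G.velocity_inv hγ)).unique
    (G.velocity_target hγ)
    (Eventually.of_forall fun t => G.source_inv_eq_target _)

theorem dTarget_dInv (x : Γ) (X : E) : G.dTarget (G.inv x) (G.dInv x X) = G.dSource x X := by
  obtain ⟨γ, hγ⟩ := exists_hasVelocity (I := I) x X
  exact (G.velocity_target (G.velocity_inv hγ)).unique
    (G.velocity_source hγ)
    (Eventually.of_forall fun t => (G.source_eq_target_inv _).symm)

theorem dMul_dInv (x : Γ) (X : E) :
    G.dMul x (G.inv x) (X, G.dInv x X) = G.dUnit (G.target x) (G.dTarget x X) := by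
  obtain ⟨γ, hγ⟩ := exists_hasVelocity (I := I) x X
  exact (G.velocity_mul hγ (G.velocity_inv hγ)
    (Eventually.of_forall fun t => G.source_eq_target_inv _)).unique
    (G.velocity_unit (G.velocity_target hγ))
    (Eventually.of_forall fun t => G.mul_inv _)

variable [IsManifold I₀ ∞ Γ₀] [I₀.Boundaryless]

/-- At a unit, the tangent map of the product is given by addition. -/
theorem dMul_unit_unit (u : Γ₀)
    (h : G.dSource (G.unit u) X = G.dTarget (G.unit u) Y) :
    G.dMul (G.unit u) (G.unit u) (X, Y) = X + Y - G.dUnit u (G.dTarget (G.unit u) Y) := by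
  have h1 := G.dMul_dUnit (G.source_unit u) X
  have h2 := G.dUnit_dMul (G.target_unit u) Y
  have h3 := G.dUnit_dMul (G.target_unit u) (G.dUnit u (G.dTarget (G.unit u) Y))
  rw [G.dTarget_dUnit] at h3
  rw [h] at h1
  -- Each of the three pairs is composable and has a factor tangent to the units, so the
  -- differentiated unit laws give its product.
  have h4 : ((X, Y) : E × E) = (X, G.dUnit u (G.dTarget (G.unit u) Y))
      + (G.dUnit u (G.dTarget (G.unit u) Y), Y)
      - (G.dUnit u (G.dTarget (G.unit u) Y), G.dUnit u (G.dTarget (G.unit u) Y)) := by simp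
  rw [h4, map_sub, map_add, h1, h2, h3]

end

end LieGroupoid

end GroupoidTangent

/-! ### Consequences of the conditions on the graph. -/

section SymplecticAndPoissonGroupoids

variable {E : Type*} [NormedAddCommGroup E] [NormedSpace ℝ E]
  {H : Type*} [TopologicalSpace H] {I : ModelWithCorners ℝ E H} [I.Boundaryless]
  {E₀ : Type*} [NormedAddCommGroup E₀] [NormedSpace ℝ E₀]
  {H₀ : Type*} [TopologicalSpace H₀] {I₀ : ModelWithCorners ℝ E₀ H₀}
  {Γ : Type*} [TopologicalSpace Γ] [ChartedSpace H Γ]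
  {Γ₀ : Type*} [TopologicalSpace Γ₀] [ChartedSpace H₀ Γ₀]

/-- The differential of a function which is constant on the fibers of a submersion kills the
vertical tangent vectors. -/
theorem Manifold.IsSubmersion.differentialAt_eq_zero {s : Γ → Γ₀}
    (hs : Manifold.IsSubmersion I I₀ ∞ s) {f : Γ → ℝ} (hf : ContMDiff I 𝓘(ℝ, ℝ) ∞ f)
    (hfs : ∀ x y, s x = s y → f x = f y) {x : Γ} {v : E} (hv : tangentAt I I₀ s x v = 0) :
    differentialAt I f x v = 0 := by
  have hm : v ∈ tangentSet I (s ⁻¹' {s x}) x := by rw [hs.tangentSet_fiber]; exact hv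
  obtain ⟨γ, hγ, e⟩ := mem_tangentSet.1 hm
  exact (hγ.comp hf.contMDiffAt).unique (HasVelocity.const (f x)) (e.mono fun t ht => hfs _ _ ht)

namespace LieGroupoid

variable [IsManifold I ∞ Γ] (G : LieGroupoid I I₀ Γ Γ₀)

/-! ### Symplectic groupoids: orthogonality of the fibers and involution. -/

section Symplectic

variable {G} {Ω : TwoForm I Γ}

/-- The inclusion of the tangent space of the graph in its orthogonal: `m^*ω = pr₁^*ω + pr₂^*ω` on
composable pairs. -/
theorem IsSymplecticGroupoid.isotropic (h : G.IsSymplecticGroupoid Ω) {x y z : Γ}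
    (hm : (x, y, z) ∈ G.graph) {X Y X' Y' : E}
    (h1 : G.dSource x X = G.dTarget y Y) (h2 : G.dSource x X' = G.dTarget y Y') :
    TwoForm.valueAt Ω x ![X, X'] + TwoForm.valueAt Ω y ![Y, Y']
      - TwoForm.valueAt Ω z ![G.dMul x y (X, Y), G.dMul x y (X', Y')] = 0 := by
  have e1 := (G.mem_tangentSet_graph hm.1 hm.2).2 ⟨h1, rfl⟩
  have e2 := (G.mem_tangentSet_graph hm.1 hm.2).2 ⟨h2, rfl⟩
  rw [h.lagrangian_graph.2 _ hm] at e1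
  have := e1 _ e2
  rwa [tripleForm_apply] at this

/-- The opposite inclusion, which replaces all dimension counts. -/
theorem IsSymplecticGroupoid.mem_of_orthogonal (h : G.IsSymplecticGroupoid Ω) {x y z : Γ}
    (hm : (x, y, z) ∈ G.graph) {U V W : E}
    (ho : ∀ X Y : E, G.dSource x X = G.dTarget y Y →
      TwoForm.valueAt Ω x ![U, X] + TwoForm.valueAt Ω y ![V, Y]
        - TwoForm.valueAt Ω z ![W, G.dMul x y (X, Y)] = 0) :
    G.dSource x U = G.dTarget y V ∧ W = G.dMul x y (U, V) := by
  rw [← G.mem_tangentSet_graph hm.1 hm.2, h.lagrangian_graph.2 _ hm]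
  rintro ⟨X, Y, Z⟩ hZ
  obtain ⟨h1, rfl⟩ := (G.mem_tangentSet_graph hm.1 hm.2).1 hZ
  rw [tripleForm_apply]
  exact ho X Y h1

/-- Pair the tangent vectors `(u, 0, u)` and `(0, v', v)` of the graph, where `v'` is the left
translate of `v` to the unit: only the third term can be nonzero, so it vanishes. -/
theorem IsSymplecticGroupoid.vertical_orthogonal (h : G.IsSymplecticGroupoid Ω) {c : Γ} {u v : E}
    (hu : G.dSource c u = 0) (hv : G.dTarget c v = 0) : TwoForm.valueAt Ω c ![u, v] = 0 := by
  obtain ⟨h1, h2⟩ := dMul_leftTranslate hv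
  have h3 := h.isotropic (G.mem_graph_mul_unit c) (X := u) (Y := 0) (X' := 0)
    (by rw [hu, map_zero]) (by rw [h1, map_zero])
  rw [dMul_unit_of_dSource_eq_zero hu, h2] at h3
  have e1 := alternating_zero_right (TwoForm.valueAt Ω c) u
  have e2 := alternating_zero_left (TwoForm.valueAt Ω (G.unit (G.source c)))
    (G.dMul (G.inv c) c (0, v))
  linarith

/-- For `(X, Y, Z)` tangent to the graph, `X - Z` is killed by `dα` because `α(xy) = α(x)`. So `(u,
0, u)` is orthogonal to the graph, hence tangent to it, and composability reads `dβ(u) = dα(0)`. -/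
theorem IsSymplecticGroupoid.dSource_eq_zero (h : G.IsSymplecticGroupoid Ω) {c : Γ} {u : E}
    (hu : ∀ v : E, G.dTarget c v = 0 → TwoForm.valueAt Ω c ![u, v] = 0) : G.dSource c u = 0 := by
  refine (h.mem_of_orthogonal (G.mem_graph_mul_unit c) (U := u) (V := 0) (W := u) ?_).1.trans
    (map_zero _)
  intro X Y hXY
  have hm := G.mem_graph_mul_unit c
  have h1 := dTarget_dMul hm.1 hXY
  rw [← hm.2] at h1
  dsimp only at h1
  have h2 := hu (X - G.dMul c (G.unit (G.source c)) (X, Y)) (by rw [map_sub, h1, sub_self])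
  have e1 := alternating_sub_right (TwoForm.valueAt Ω c) u X
    (G.dMul c (G.unit (G.source c)) (X, Y))
  have e2 := alternating_zero_left (TwoForm.valueAt Ω (G.unit (G.source c))) Y
  linarith

/-- The mirror argument, with `(0, u, u)` and `β(xy) = β(y)`. -/
theorem IsSymplecticGroupoid.dTarget_eq_zero (h : G.IsSymplecticGroupoid Ω) {c : Γ} {u : E}
    (hu : ∀ v : E, G.dSource c v = 0 → TwoForm.valueAt Ω c ![u, v] = 0) : G.dTarget c u = 0 := by
  refine (h.mem_of_orthogonal (G.mem_graph_unit_mul c) (U := 0) (V := u) (W := u) ?_).1.symm.trans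
    (map_zero _)
  intro X Y hXY
  have hm := G.mem_graph_unit_mul c
  have h1 := dSource_dMul hm.1 hXY
  rw [← hm.2] at h1
  dsimp only at h1
  have h2 := hu (Y - G.dMul (G.unit (G.target c)) c (X, Y)) (by rw [map_sub, h1, sub_self])
  have e1 := alternating_sub_right (TwoForm.valueAt Ω c) u Y
    (G.dMul (G.unit (G.target c)) c (X, Y))
  have e2 := alternating_zero_left (TwoForm.valueAt Ω (G.unit (G.target c))) X
  linarith

/-- The tangent spaces of the fibers of the source and target maps are the symplectic orthogonal
of each other. -/
theorem IsSymplecticGroupoid.tangentSet_source_fiber (h : G.IsSymplecticGroupoid Ω) (c : Γ) :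
    tangentSet I (G.source ⁻¹' {G.source c}) c
      = symplecticOrthogonal Ω c (tangentSet I (G.target ⁻¹' {G.target c}) c) := by
  rw [G.submersion_source.tangentSet_fiber, G.submersion_target.tangentSet_fiber]
  ext u
  exact ⟨fun hu v hv => h.vertical_orthogonal hu hv, fun hu => h.dSource_eq_zero hu⟩

theorem IsSymplecticGroupoid.tangentSet_target_fiber (h : G.IsSymplecticGroupoid Ω) (c : Γ) :
    tangentSet I (G.target ⁻¹' {G.target c}) c
      = symplecticOrthogonal Ω c (tangentSet I (G.source ⁻¹' {G.source c}) c) := by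
  rw [G.submersion_source.tangentSet_fiber, G.submersion_target.tangentSet_fiber]
  ext u
  refine ⟨fun hu v hv => ?_, fun hu => h.dTarget_eq_zero hu⟩
  have e1 := alternating_swap (TwoForm.valueAt Ω c) v u
  have e2 := h.vertical_orthogonal (c := c) hv hu
  rw [e2, neg_zero] at e1
  exact e1

/-- On a symplectic groupoid, a function which is constant on the fibers of the target map and a
function which is constant on the fibers of the source map are in involution. -/
theorem IsSymplecticGroupoid.poissonBracket_eq_zero [FiniteDimensional ℝ E]
    (h : G.IsSymplecticGroupoid Ω) {f g : Γ → ℝ}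
    (hf : ContMDiff I 𝓘(ℝ, ℝ) ∞ f) (hg : ContMDiff I 𝓘(ℝ, ℝ) ∞ g)
    (hfα : ∀ x y, G.target x = G.target y → f x = f y)
    (hgβ : ∀ x y, G.source x = G.source y → g x = g y) (x : Γ) :
    poissonBracket I (symplecticPoisson I Ω) f g x = 0 := by
  have hnd : ∀ v : E, v ≠ 0 → ∃ w : E, TwoForm.valueAt Ω x ![v, w] ≠ 0 :=
    h.symplectic.nondegenerate x
  -- `v` is the Hamiltonian vector of `f`: it is orthogonal to the kernel of `dα`, hence vertical
  -- for `β`, and the bracket equals `dg(v)`.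
  obtain ⟨v, hv⟩ := negInterior_surjective (TwoForm.valueAt Ω x) hnd (differentialAt I f x)
  have h1 : G.dSource x v = 0 := by
    refine h.dSource_eq_zero fun w hw => ?_
    have e1 := negInterior_apply (TwoForm.valueAt Ω x) v w
    rw [hv] at e1
    have e2 := G.submersion_target.differentialAt_eq_zero hf hfα (x := x) hw
    exact neg_eq_zero.1 (e1.symm.trans e2)
  have h2 := dualBivector_apply (TwoForm.valueAt Ω x) hnd v (differentialAt I g x)
  rw [hv] at h2
  exact h2.trans (G.submersion_source.differentialAt_eq_zero hg hgβ h1)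

end Symplectic

/-! ### Poisson groupoids: conormal covectors of the graph and involution. -/

section Poisson

variable {G} {P : BivectorField I Γ}

/-- The hypotheses say that `(a, b, c)` and `(a', b', c')` annihilate the tangent space of the
graph. This is the Poisson counterpart of `isotropic`. -/
theorem IsPoissonGroupoid.conormal_eq_zero (h : G.IsPoissonGroupoid P) {x y z : Γ}
    (hm : (x, y, z) ∈ G.graph) {a b c a' b' c' : E →L[ℝ] ℝ}
    (h1 : ∀ X Y, G.dSource x X = G.dTarget y Y → a X + b Y + c (G.dMul x y (X, Y)) = 0)
    (h2 : ∀ X Y, G.dSource x X = G.dTarget y Y → a' X + b' Y + c' (G.dMul x y (X, Y)) = 0) :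
    BivectorField.valueAt P x ![a, a'] + BivectorField.valueAt P y ![b, b']
      - BivectorField.valueAt P z ![c, c'] = 0 := by
  have key : ∀ a b c : E →L[ℝ] ℝ,
      (∀ X Y, G.dSource x X = G.dTarget y Y → a X + b Y + c (G.dMul x y (X, Y)) = 0) →
      ∀ v ∈ tangentSet (I.prod (I.prod I)) G.graph (x, y, z), tripleCovector a b c v = 0 := by
    rintro a b c h ⟨X, Y, Z⟩ hv
    obtain ⟨h1, rfl⟩ := (G.mem_tangentSet_graph hm.1 hm.2).1 hv
    exact (add_assoc _ _ _).symm.trans (h X Y h1)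
  rw [← tripleBivector_apply]
  exact h.coisotropic_graph.apply_eq_zero hm (key a b c h1) (key a' b' c' h2)

/-- On a Poisson groupoid, a function which is constant on the fibers of the target map and a
function which is constant on the fibers of the source map are in involution. -/
theorem IsPoissonGroupoid.poissonBracket_eq_zero
    (h : G.IsPoissonGroupoid P) {f g : Γ → ℝ}
    (hf : ContMDiff I 𝓘(ℝ, ℝ) ∞ f) (hg : ContMDiff I 𝓘(ℝ, ℝ) ∞ g)
    (hfα : ∀ x y, G.target x = G.target y → f x = f y)
    (hgβ : ∀ x y, G.source x = G.source y → g x = g y) (c : Γ) :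
    poissonBracket I P f g c = 0 := by
  have hm := G.mem_graph_mul_unit c
  set ζ : E →L[ℝ] ℝ := differentialAt I f c
  set η : E →L[ℝ] ℝ := differentialAt I g c
  set η' : E →L[ℝ] ℝ := differentialAt I g (G.unit (G.source c))
  -- The differentials of `f(x) - f(z)` and `g(y) - g(z)`, which vanish on the graph because `α(xy)
  -- = α(x)` and `β(xy) = β(y)`.
  have h1 := h.conormal_eq_zero hm (a := ζ) (b := 0) (c := -ζ) (a' := 0) (b' := η') (c' := -η)
    (fun X Y hXY => by
      have h1 := dTarget_dMul hm.1 hXY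
      rw [← hm.2] at h1
      dsimp only at h1
      have e : ζ (X - G.dMul c (G.unit (G.source c)) (X, Y)) = 0 :=
        G.submersion_target.differentialAt_eq_zero hf hfα (x := c)
          (show G.dTarget c (X - G.dMul c (G.unit (G.source c)) (X, Y)) = 0 by
            rw [map_sub, h1, sub_self])
      rw [map_sub] at e
      simp only [zero_apply, neg_apply]
      linarith)
    (fun X Y hXY => by
      obtain ⟨γ, δ, hγ, hδ, e⟩ := G.exists_composable_velocity hm.1 hXY
      have e1 := (G.velocity_mul hγ hδ e).comp (I' := 𝓘(ℝ, ℝ)) hg.contMDiffAt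
      rw [← hm.2] at e1
      have e2 : η (G.dMul c (G.unit (G.source c)) (X, Y)) = η' Y :=
        e1.unique (hδ.comp hg.contMDiffAt) (e.mono fun t ht => hgβ _ _ (G.source_mul ht))
      simp only [zero_apply, neg_apply, e2]
      ring)
  have e1 := alternating_zero_right (BivectorField.valueAt P c) ζ
  have e2 := alternating_zero_left (BivectorField.valueAt P (G.unit (G.source c))) η'
  have e3 := alternating_neg_neg (BivectorField.valueAt P c) ζ η
  change BivectorField.valueAt P c ![ζ, η] = 0
  linarith

end Poisson

/-! ### The units and the inverse map. -/

section Units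

variable [IsManifold I₀ ∞ Γ₀] [I₀.Boundaryless] {G}

/-- A vector tangent to the units, repeated three times, is tangent to the graph, and `ω + ω - ω =
ω`. -/
theorem IsSymplecticGroupoid.units_isotropic {Ω : TwoForm I Γ} (h : G.IsSymplecticGroupoid Ω)
    (u : Γ₀) (a b : E₀) : TwoForm.valueAt Ω (G.unit u) ![G.dUnit u a, G.dUnit u b] = 0 := by
  have key : ∀ a, G.dSource (G.unit u) (G.dUnit u a) = G.dTarget (G.unit u) (G.dUnit u a) :=
    fun a => by rw [G.dSource_dUnit, G.dTarget_dUnit]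
  have h1 := h.isotropic (G.mem_graph_unit u) (key a) (key b)
  rw [G.dMul_unit_unit u (key a), G.dMul_unit_unit u (key b), G.dTarget_dUnit, G.dTarget_dUnit,
    add_sub_cancel_right, add_sub_cancel_right] at h1
  linarith

/-- The submanifold of units of a symplectic groupoid is Lagrangian. -/
theorem IsSymplecticGroupoid.isLagrangianSubmanifold_units {Ω : TwoForm I Γ}
    (h : G.IsSymplecticGroupoid Ω) : IsLagrangianSubmanifold I Ω (range G.unit) := by
  refine ⟨G.embedding_unit.isSubmanifold_range, ?_⟩
  rintro _ ⟨u, rfl⟩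
  rw [G.tangentSet_range_unit]
  ext w
  constructor
  · rintro ⟨a, rfl⟩ _ ⟨b, rfl⟩
    exact h.units_isotropic u a b
  · intro hw
    -- By `dMul_unit_unit`, pairing `(w, w, w)` with the graph leaves only `ω(w, ·)` on a vector
    -- tangent to the units, which is zero. Tangency then reads `w = w + w - dε(dα(w))`, that is, `w
    -- = dε(dα(w))`.
    obtain ⟨h1, h2⟩ := h.mem_of_orthogonal (G.mem_graph_unit u) (U := w) (V := w) (W := w) (by
      intro X Y hXY
      rw [G.dMul_unit_unit u hXY]
      have e1 := alternating_sub_right (TwoForm.valueAt Ω (G.unit u)) w (X + Y)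
        (G.dUnit u (G.dTarget (G.unit u) Y))
      have e2 := alternating_sub_right (TwoForm.valueAt Ω (G.unit u)) w (X + Y) Y
      rw [add_sub_cancel_right] at e2
      have e3 : TwoForm.valueAt Ω (G.unit u) ![w, G.dUnit u (G.dTarget (G.unit u) Y)] = 0 :=
        hw _ ⟨G.dTarget (G.unit u) Y, rfl⟩
      linarith)
    rw [G.dMul_unit_unit u h1] at h2
    refine ⟨G.dTarget (G.unit u) w, ?_⟩
    have h3 := eq_sub_iff_add_eq.1 h2
    exact add_left_cancel h3

/-- The inverse map of a symplectic groupoid is antisymplectic. -/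
theorem IsSymplecticGroupoid.pullbackForm_inv {Ω : TwoForm I Γ} (h : G.IsSymplecticGroupoid Ω) :
    pullbackForm I I G.inv Ω = -Ω := by
  funext x
  refine ContinuousAlternatingMap.ext fun m => ?_
  obtain ⟨v, w, rfl⟩ : ∃ v w : E, m = ![v, w] :=
    ⟨m 0, m 1, by ext i; fin_cases i <;> rfl⟩
  -- The products of `v` and `w` with their images under `dι` are tangent to the units, where the
  -- form vanishes.
  have h1 := h.isotropic (G.mem_graph_inv x) (G.dTarget_dInv x v).symm (G.dTarget_dInv x w).symm
  rw [G.dMul_dInv, G.dMul_dInv, h.units_isotropic] at h1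
  have e := comp_vec2 (TwoForm.valueAt Ω (G.inv x)) (G.dInv x) v w
  refine e.trans ?_
  change _ = -TwoForm.valueAt Ω x ![v, w]
  linarith

/-- At a unit the product is addition modulo vectors tangent to the units, so a covector `ζ` that
kills these makes `(ζ, ζ, -ζ)` conormal to the graph. -/
theorem IsPoissonGroupoid.units_conormal {P : BivectorField I Γ} (h : G.IsPoissonGroupoid P)
    (u : Γ₀) {ζ η : E →L[ℝ] ℝ} (hζ : ∀ a, ζ (G.dUnit u a) = 0) (hη : ∀ a, η (G.dUnit u a) = 0) :
    BivectorField.valueAt P (G.unit u) ![ζ, η] = 0 := by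
  have key : ∀ ζ : E →L[ℝ] ℝ, (∀ a, ζ (G.dUnit u a) = 0) → ∀ X Y,
      G.dSource (G.unit u) X = G.dTarget (G.unit u) Y →
      ζ X + ζ Y + (-ζ) (G.dMul (G.unit u) (G.unit u) (X, Y)) = 0 := by
    intro ζ hζ X Y hXY
    rw [G.dMul_unit_unit u hXY, neg_apply, map_sub, hζ, map_add]
    ring
  have h1 := h.conormal_eq_zero (G.mem_graph_unit u) (key ζ hζ) (key η hη)
  have e3 := alternating_neg_neg (BivectorField.valueAt P (G.unit u)) ζ η
  linarith

/-- The submanifold of units of a Poisson groupoid is coisotropic. -/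
theorem IsPoissonGroupoid.isCoisotropicSubmanifold_units {P : BivectorField I Γ}
    (h : G.IsPoissonGroupoid P) : IsCoisotropicSubmanifold I P (range G.unit) := by
  refine ⟨G.embedding_unit.isSubmanifold_range, fun U f g hU hf hg hf0 hg0 => ?_⟩
  rintro _ ⟨⟨u, rfl⟩, hu⟩
  have key : ∀ f : Γ → ℝ, ContMDiffOn I 𝓘(ℝ, ℝ) ∞ f U → (∀ x ∈ range G.unit ∩ U, f x = 0) →
      ∀ a, differentialAt I f (G.unit u) (G.dUnit u a) = 0 := by
    intro f hf hf0 a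
    obtain ⟨c, hc⟩ := exists_hasVelocity (I := I₀) u a
    have h1 := G.velocity_unit hc
    have h2 := h1.continuousAt.preimage_mem_nhds (t := U)
      (by rw [h1.map_zero]; exact hU.mem_nhds hu)
    exact (h1.comp (hf.contMDiffAt (hU.mem_nhds hu))).unique
      (HasVelocity.const (0 : ℝ)) (by
        filter_upwards [h2] with t ht
        exact hf0 _ ⟨mem_range_self _, ht⟩)
  exact h.units_conormal u (key f hf hf0) (key g hg hg0)

/-- The inverse map of a Poisson groupoid is an anti-Poisson map. -/
theorem IsPoissonGroupoid.pushBivector_inv {P : BivectorField I Γ} (h : G.IsPoissonGroupoid P)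
    (x : Γ) : pushBivector I I G.inv P x = -P (G.inv x) := by
  refine ContinuousAlternatingMap.ext fun m => ?_
  obtain ⟨ζ, η, rfl⟩ : ∃ ζ η : E →L[ℝ] ℝ, m = ![ζ, η] :=
    ⟨m 0, m 1, by ext i; fin_cases i <;> rfl⟩
  set u := G.target x
  -- the projection onto the kernel of the tangent map of `target` along the units, followed by
  -- the left translation by the inverse of `x`
  set L : E →L[ℝ] E := (G.dMul (G.inv x) (G.unit u)).comp ((ContinuousLinearMap.inr ℝ E E).comp
    (ContinuousLinearMap.id ℝ E - (G.dUnit u).comp (G.dTarget (G.unit u)))) with hL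
  have hL' : ∀ Z, L Z = G.dMul (G.inv x) (G.unit u)
      (0, Z - G.dUnit u (G.dTarget (G.unit u) Z)) := fun Z => rfl
  have hm := G.mem_graph_inv x
  have hLu : ∀ a, L (G.dUnit u a) = 0 := fun a => by
    rw [hL', G.dTarget_dUnit, sub_self, ← Prod.zero_eq_mk, map_zero]
  -- Left translation of the product by the inverse recovers `Y`, as in `x⁻¹(xy) = y`; removing the
  -- component along the units subtracts `dι(X)`.
  have hLm : ∀ X Y, G.dSource x X = G.dTarget (G.inv x) Y →
      L (G.dMul x (G.inv x) (X, Y)) = Y - G.dInv x X := by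
    intro X Y hXY
    have h1 := dTarget_dMul hm.1 hXY
    have h2 := dMul_dInv_dMul hm.1 hXY
    rw [G.mul_inv] at h1 h2
    have h3 := G.dMul_dUnit (G.source_inv_eq_target x) (G.dInv x X)
    rw [G.dSource_dInv] at h3
    have h4 : ((0, G.dMul x (G.inv x) (X, Y) - G.dUnit u (G.dTarget x X)) : E × E)
        = (G.dInv x X, G.dMul x (G.inv x) (X, Y)) - (G.dInv x X, G.dUnit u (G.dTarget x X)) := by
      simp
    rw [hL', h1, h4, map_sub, h2, h3]
  -- Hence `(ξ ∘ dι, -ξ, ξ ∘ L)` is conormal to the graph. Its third component kills the tangent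
  -- vectors of the units by `hLu`, so `units_conormal` removes the third term.
  have key : ∀ ξ : E →L[ℝ] ℝ, ∀ X Y, G.dSource x X = G.dTarget (G.inv x) Y →
      (ξ.comp (G.dInv x)) X + (-ξ) Y + (ξ.comp L) (G.dMul x (G.inv x) (X, Y)) = 0 := by
    intro ξ X Y hXY
    simp only [ContinuousLinearMap.comp_apply, neg_apply, hLm X Y hXY, map_sub]
    ring
  have h1 := h.conormal_eq_zero hm (key ζ) (key η)
  rw [h.units_conormal u (fun a => by rw [ContinuousLinearMap.comp_apply, hLu, map_zero])
    (fun a => by rw [ContinuousLinearMap.comp_apply, hLu, map_zero])] at h1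
  have e3 := alternating_neg_neg (BivectorField.valueAt P (G.inv x)) ζ η
  have e := comp_vec2 (BivectorField.valueAt P x)
    (ContinuousLinearMap.precomp ℝ (G.dInv x)) ζ η
  refine e.trans ?_
  change BivectorField.valueAt P x ![ζ.comp (G.dInv x), η.comp (G.dInv x)]
    = -BivectorField.valueAt P (G.inv x) ![ζ, η]
  linarith

end Units

end LieGroupoid

end SymplecticAndPoissonGroupoids

end

theorem theorem1
    {E : Type*} [NormedAddCommGroup E] [NormedSpace ℝ E] [FiniteDimensional ℝ E]
    {H : Type*} [TopologicalSpace H] (I : ModelWithCorners ℝ E H) [I.Boundaryless]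
    {E₀ : Type*} [NormedAddCommGroup E₀] [NormedSpace ℝ E₀] [FiniteDimensional ℝ E₀]
    {H₀ : Type*} [TopologicalSpace H₀] (I₀ : ModelWithCorners ℝ E₀ H₀) [I₀.Boundaryless]
    {Γ : Type*} [TopologicalSpace Γ] [ChartedSpace H Γ] [IsManifold I ∞ Γ]
    {Γ₀ : Type*} [TopologicalSpace Γ₀] [ChartedSpace H₀ Γ₀] [IsManifold I₀ ∞ Γ₀]
    (G : LieGroupoid I I₀ Γ Γ₀) :
    (∀ Ω : TwoForm I Γ, G.IsSymplecticGroupoid Ω →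
      (∀ c : Γ,
        tangentSet I (G.source ⁻¹' {G.source c}) c
            = symplecticOrthogonal Ω c (tangentSet I (G.target ⁻¹' {G.target c}) c) ∧
        tangentSet I (G.target ⁻¹' {G.target c}) c
            = symplecticOrthogonal Ω c (tangentSet I (G.source ⁻¹' {G.source c}) c)) ∧
      (∀ f g : Γ → ℝ, ContMDiff I 𝓘(ℝ, ℝ) ∞ f → ContMDiff I 𝓘(ℝ, ℝ) ∞ g →
        (∀ x y, G.target x = G.target y → f x = f y) →
        (∀ x y, G.source x = G.source y → g x = g y) →
        ∀ x, poissonBracket I (symplecticPoisson I Ω) f g x = 0) ∧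
      IsLagrangianSubmanifold I Ω (Set.range G.unit) ∧
      pullbackForm I I G.inv Ω = -Ω) ∧
    (∀ P : BivectorField I Γ, G.IsPoissonGroupoid P →
      (∀ f g : Γ → ℝ, ContMDiff I 𝓘(ℝ, ℝ) ∞ f → ContMDiff I 𝓘(ℝ, ℝ) ∞ g →
        (∀ x y, G.target x = G.target y → f x = f y) →
        (∀ x y, G.source x = G.source y → g x = g y) →
        ∀ x, poissonBracket I P f g x = 0) ∧
      IsCoisotropicSubmanifold I P (Set.range G.unit) ∧
      ∀ x, pushBivector I I G.inv P x = -P (G.inv x)) := by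
  refine ⟨fun Ω h => ⟨fun c => ⟨h.tangentSet_source_fiber c, h.tangentSet_target_fiber c⟩,
    fun f g hf hg hfα hgβ x => h.poissonBracket_eq_zero hf hg hfα hgβ x,
    h.isLagrangianSubmanifold_units, h.pullbackForm_inv⟩,
    fun P h => ⟨fun f g hf hg hfα hgβ x => h.poissonBracket_eq_zero hf hg hfα hgβ x,
    h.isCoisotropicSubmanifold_units, h.pushBivector_inv⟩⟩
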